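/- Fix constants $\alpha>2$ (path loss) and $\beta>0$ (SINR threshold), and let $N\ge 0$ be the ambient noise. A link $i$ is an ordered pair $(s_i,r_i)$ of distinct points of the Euclidean plane (sender and receiver), with length $l_i=d(s_i,r_i)$. For a power assignment $P$ with positive values, a finite set $L$ of links is $P$-feasible if for every $i\in L$ $$\frac{P(i)}{l_i^\alpha}\ \ge\ \beta\Bigl(\sum_{j\in L\setminus\{i\}}\frac{P(j)}{d(s_j,r_i)^\alpha}+N\Bigr),$$ where a term with $s_j=r_i$ counts as $+\infty$. For $\varepsilon>0$, $L$ is interference limited under $P$ if $P(i)\ge(1+\varepsilon)\beta N l_i^\alpha$ for all $i\in L$. A coloring schedule of a finite set $S$ of links is a partition of $S$; its length is the number of parts. Let $\Delta(S)$ be the ratio of the longest to the shortest link length in $S$, and let $\log^* x$ be the least number of applications of $\log_2$ to $x$ that gives a value at most $1$. Let $R$ be any finite set of points in the plane and let $S$ be a set of links obtained by orienting each edge of a Euclidean minimum spanning tree of $R$ in an arbitrary one of its two directions. Then: 1. (Global power control.) There is a constant $K$, depending only on $\alpha$ and $\beta$, such that for all such $R,S$, all $N\ge0$ and all $\varepsilon>0$,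 $S$ has a coloring schedule of length at most $K\max\{1,\log^*\Delta(S)\}$ in which each part $A$ is $P_A$-feasible, and interference limited, for some power assignment $P_A$ on $A$. 2. (Oblivious power.) There is $\tau\in(0,1)$, depending only on $\alpha$, and for every $\varepsilon>0$ a constant $K$, depending only on $\alpha,\beta,\varepsilon$, such that for all such $R,S$, all $N\ge 0$, and all $C>0$ for which $S$ is interference limited under the power assignment $P_\tau(i)=C\,l_i^{\tau\alpha}$, $S$ has a coloring schedule of length at most $K\max\{1,\log_2\log_2\Delta(S)\}$ in which each part is $P_\tau$-feasible. (For $\Delta(S)=1$ the maximum is read as $1$.) -/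

import Mathlib

open scoped BigOperators

/-- The Euclidean plane. -/
abbrev Plane : Type := EuclideanSpace ℝ (Fin 2)

/-- A communication link: a request from a sender node to a (different) receiver node. -/
@[ext]
structure Link where
  sender : Plane
  receiver : Plane
  sender_ne_receiver : sender ≠ receiver

noncomputable instance : DecidableEq Link := Classical.decEq Link

/-- The length `l_i = d(s_i, r_i)` of a link. -/
noncomputable def Link.length (i : Link) : ℝ := dist i.sender i.receiver

/-- The ratio between the longest and the shortest link length of a set of links
(the empty set gets the value `1`). -/
noncomputable def lengthDiversity (L : Finset Link) : ℝ :=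
  if h : L.Nonempty then L.sup' h Link.length / L.inf' h Link.length else 1

/-! ### The physical model -/

/-- The received signal `S_i = P(i) / l_i ^ α`. -/
noncomputable def signal (α : ℝ) (P : Link → ℝ) (i : Link) : ℝ :=
  P i / i.length ^ α

/-- The interference `I_{ji} = P(j) / d(s_j, r_i) ^ α` caused by `j` on `i`, for `s_j ≠ r_i`. -/
noncomputable def interference (α : ℝ) (P : Link → ℝ) (j i : Link) : ℝ :=
  P j / dist j.sender i.receiver ^ α

/-- `L` is `P`-feasible: the powers are positive and every link `i` of `L` meets
`S_i ≥ β (∑_{j ∈ L \ {i}} I_{ji} + N)`.  A sender located at the receiver of another link of `L`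
causes infinite interference there, so that case is excluded separately (the real quotient in
`interference` would be zero). -/
def IsPFeasible (α β N : ℝ) (P : Link → ℝ) (L : Finset Link) : Prop :=
  (∀ i ∈ L, 0 < P i) ∧
  ∀ i ∈ L,
    (∀ j ∈ L, j ≠ i → j.sender ≠ i.receiver) ∧
    β * ((∑ j ∈ L.erase i, interference α P j i) + N) ≤ signal α P i

/-- Under the power assignment `P`, the links of `L` are interference limited:
`P(i) ≥ (1 + ε) β N l_i ^ α`. -/
def IsInterferenceLimited (α β N ε : ℝ) (P : Link → ℝ) (L : Finset Link) : Prop :=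
  ∀ i ∈ L, (1 + ε) * β * N * i.length ^ α ≤ P i

/-- `L` is feasible (global power control): it is `P`-feasible for some power assignment `P`,
which moreover leaves the links of `L` interference limited. -/
def IsFeasible (α β N ε : ℝ) (L : Finset Link) : Prop :=
  ∃ P : Link → ℝ, IsInterferenceLimited α β N ε P L ∧ IsPFeasible α β N P L

/-- The oblivious power scheme `P_τ(i) = C l_i ^ (τ α)`. -/
noncomputable def obliviousPower (α τ C : ℝ) (i : Link) : ℝ :=
  C * i.length ^ (τ * α)

/-! ### Minimum spanning trees -/

/-- The total Euclidean length of the edges of a graph on a finite set of points. -/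
noncomputable def totalLength {R : Finset Plane} (T : SimpleGraph R) : ℝ :=
  ∑ e ∈ (Set.toFinite T.edgeSet).toFinset,
    Sym2.lift ⟨fun u v : R => dist (u : Plane) (v : Plane), fun _ _ => dist_comm _ _⟩ e

/-- `T` is a (Euclidean) minimum spanning tree of the point set `R`. -/
def IsMST {R : Finset Plane} (T : SimpleGraph R) : Prop :=
  T.IsTree ∧ ∀ T' : SimpleGraph R, T'.IsTree → totalLength T ≤ totalLength T'

/-- The set of links `S` arises by orienting each edge of `T` in exactly one of its two
directions. -/
def IsOrientation {R : Finset Plane} (T : SimpleGraph R) (S : Finset Link) : Prop :=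
  (∀ i ∈ S, ∃ u v : R, T.Adj u v ∧ i.sender = u ∧ i.receiver = v) ∧
  ∀ u v : R, T.Adj u v →
    Xor (∃ i ∈ S, i.sender = u ∧ i.receiver = v) (∃ i ∈ S, i.sender = v ∧ i.receiver = u)

/-! ### The iterated logarithm -/

/-- Iterating the binary logarithm leads below `1` after finitely many steps. -/
theorem exists_iterate_logb_le_one (x : ℝ) : ∃ n : ℕ, (Real.logb 2)^[n] x ≤ 1 := by
  have key : ∀ m : ℕ, ∀ y : ℝ, y ≤ m + 2 → ∃ n : ℕ, (Real.logb 2)^[n] y ≤ 1 := by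
    intro m
    induction m with
    | zero =>
      intro y hy
      rcases le_or_gt y 1 with h | h
      · exact ⟨0, h⟩
      · refine ⟨1, ?_⟩
        rw [Function.iterate_one, Real.logb_le_iff_le_rpow (by norm_num) (by linarith)]
        simpa using hy
    | succ m ih =>
      intro y hy
      rcases le_or_gt y 1 with h | h
      · exact ⟨0, h⟩
      · have hlog : Real.logb 2 y ≤ m + 2 := by
          rw [Real.logb_le_iff_le_rpow (by norm_num) (by linarith)]
          have h1 : ((m : ℝ) + 3) ≤ 2 ^ (m + 2) := by
            have h2 : m + 3 ≤ 2 ^ (m + 2) := Nat.lt_two_pow_self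
            exact_mod_cast h2
          have h3 : (2 : ℝ) ^ ((m : ℝ) + 2) = 2 ^ (m + 2) := by
            rw [← Real.rpow_natCast]; push_cast; rfl
          rw [h3]
          push_cast at hy
          linarith
        obtain ⟨n, hn⟩ := ih _ hlog
        exact ⟨n + 1, by rwa [Function.iterate_succ_apply]⟩
  obtain ⟨m, hm⟩ := exists_nat_ge x
  exact key m x (by linarith)

/-- `log* x`: the number of times the binary logarithm has to be applied to `x` until the result is
at most `1`. -/
noncomputable def logStar (x : ℝ) : ℕ :=
  sInf {n : ℕ | (Real.logb 2)^[n] x ≤ 1}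

/-! Minimality of the tree is used only through `ExchangeProperty`: swapping a tree edge for a
connection between its end and an end of another tree edge cannot shorten the tree. Hence two links
that start close together and point in nearly the same direction cannot both be long, and a
pigeonhole over positions and directions (`card_le_of_exchange`) bounds the number of links of
length at least `m` within distance `O(m)` of a given link.

Call two links in conflict if their distance is at most `γ * l * φ(ratio)`, with `l` the shorter
length and `φ` a slowly growing function of the length ratio. If the possible ratios are covered by
intervals `[a, b]` with `φ b ≤ B * a`, every link conflicts with boundedly many longer links per
interval, so greedy colouring from the longest link down needs `O(number of intervals)` colours
(`exists_independent_partition`).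

It remains to choose `φ` so that conflict-free sets are feasible for large `γ`. For oblivious power
`φ x = x ^ δ` works: interference is summed over dyadic length classes with a planar packing bound,
which converges because `α > 2`, and `O(log log Δ)` intervals suffice. Under power control longer
links are handled by the choice of powers (`isFeasible_of_sum_le`), only shorter ones need the
packing sum, and `φ` may be a power of a logarithm; then `O(log* Δ)` intervals suffice. -/

/-! ### Packing in the plane -/

/-- The cell of side `D` that contains a point. -/
noncomputable def gridCell (D : ℝ) (p : Plane) : ℤ × ℤ := (⌊p 0 / D⌋, ⌊p 1 / D⌋)

theorem dist_lt_of_gridCell_eq {D : ℝ} (hD : 0 < D) {p q : Plane}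
    (h : gridCell D p = gridCell D q) : dist p q < 2 * D := by
  have h0 := Int.abs_sub_lt_one_of_floor_eq_floor (congrArg Prod.fst h)
  have h1 := Int.abs_sub_lt_one_of_floor_eq_floor (congrArg Prod.snd h)
  rw [← sub_div, abs_div, abs_of_pos hD, div_lt_one hD] at h0 h1
  rw [EuclideanSpace.dist_eq, Fin.sum_univ_two, Real.dist_eq, Real.dist_eq]
  refine (Real.sqrt_lt' (by positivity)).2 ?_
  nlinarith [abs_nonneg (p 0 - q 0), abs_nonneg (p 1 - q 1)]

theorem gridCell_mem {D : ℝ} (hD : 0 < D) {p : Plane} {n : ℕ} (h : ‖p‖ ≤ n * D) :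
    gridCell D p ∈ Finset.Icc (-(n : ℤ)) n ×ˢ Finset.Icc (-(n : ℤ)) n := by
  have key : ∀ i : Fin 2, -(n : ℤ) ≤ ⌊p i / D⌋ ∧ ⌊p i / D⌋ ≤ n := by
    intro i
    have h1 : |p i| ≤ n * D := (Real.norm_eq_abs _ ▸ PiLp.norm_apply_le p i).trans h
    rw [abs_le] at h1
    have h2 : p i / D ≤ n := by rw [div_le_iff₀ hD]; exact h1.2
    have h3 : -(n : ℝ) ≤ p i / D := by rw [le_div_iff₀ hD]; linarith [h1.1]
    refine ⟨Int.le_floor.2 (by push_cast; exact h3), ?_⟩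
    have h4 : (⌊p i / D⌋ : ℝ) ≤ (n : ℤ) := (Int.floor_le _).trans (by exact_mod_cast h2)
    exact_mod_cast h4
  simp only [gridCell, Finset.mem_product, Finset.mem_Icc]
  exact ⟨key 0, key 1⟩

theorem card_grid (n : ℕ) :
    (Finset.Icc (-(n : ℤ)) n ×ˢ Finset.Icc (-(n : ℤ)) n).card = (2 * n + 1) ^ 2 := by
  rw [Finset.card_product, Int.card_Icc, sq]
  congr 1 <;> omega

theorem card_le_of_separated {ι : Type*} {s : Finset ι} {p : ι → Plane} {x : Plane} {D R : ℝ}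
    (hD : 0 < D) (hDR : D ≤ R) (hR : ∀ i ∈ s, dist (p i) x ≤ R)
    (hs : ∀ i ∈ s, ∀ j ∈ s, i ≠ j → D ≤ dist (p i) (p j)) :
    (s.card : ℝ) ≤ 49 * (R / D) ^ 2 := by
  have hR0 : 0 < R := hD.trans_le hDR
  set n := ⌈2 * R / D⌉₊
  have hn : (n : ℝ) < 2 * R / D + 1 := Nat.ceil_lt_add_one (by positivity)
  have h1 : s.card ≤ (2 * n + 1) ^ 2 := by
    rw [← card_grid]
    -- Two points in one cell of side `D / 2` are closer than `D`, so each cell holds at most one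
    -- point.
    refine Finset.card_le_card_of_injOn (fun i => gridCell (D / 2) (p i - x)) ?_ ?_
    · intro i hi
      refine gridCell_mem (by positivity) ?_
      rw [← dist_eq_norm]
      refine (hR i hi).trans ?_
      have := Nat.le_ceil (2 * R / D)
      rw [div_le_iff₀ hD] at this
      linarith
    · intro i hi j hj hij
      by_contra hne
      have h2 := dist_lt_of_gridCell_eq (by positivity) hij
      rw [dist_sub_right] at h2
      linarith [hs i hi j hj hne]
  have h2 : 1 ≤ R / D := by rwa [le_div_iff₀ hD, one_mul]
  have h3 : (2 * n + 1 : ℝ) ≤ 7 * (R / D) := by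
    rw [mul_div_assoc] at hn; linarith
  calc (s.card : ℝ) ≤ (2 * n + 1) ^ 2 := by exact_mod_cast h1
    _ ≤ (7 * (R / D)) ^ 2 := by gcongr
    _ = _ := by ring

theorem sum_le_tsum_of_fiber_le {ι : Type*} (s : Finset ι) (w : ι → ℝ) (g : ι → ℕ) (c : ℕ → ℝ)
    (hc : ∀ n, 0 ≤ c n) (hsum : Summable c)
    (h : ∀ n, ∑ i ∈ s with g i = n, w i ≤ c n) : ∑ i ∈ s, w i ≤ ∑' n, c n := by
  rw [← Finset.sum_fiberwise_of_maps_to (t := s.image g)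
    (fun i hi => Finset.mem_image_of_mem g hi)]
  exact (Finset.sum_le_sum fun n _ => h n).trans (hsum.sum_le_tsum _ fun n _ => hc n)

/-- The constant of the packing sum `sum_inv_dist_rpow_le`. -/
noncomputable def packingConst (α : ℝ) : ℝ := 196 * (1 - (2 : ℝ) ^ (2 - α))⁻¹

theorem two_rpow_two_sub_lt_one {α : ℝ} (hα : 2 < α) : (2 : ℝ) ^ (2 - α) < 1 :=
  Real.rpow_lt_one_of_one_lt_of_neg (by norm_num) (by linarith)

theorem packingConst_pos {α : ℝ} (hα : 2 < α) : 0 < packingConst α := by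
  have := two_rpow_two_sub_lt_one hα
  have : 0 < 1 - (2 : ℝ) ^ (2 - α) := by linarith
  unfold packingConst; positivity

/-- The sum of `d ^ (-α)` over the distances `d` from `x` of points that are `D`-separated and
outside the ball of radius `ρ ≥ D` about `x`. -/
theorem sum_inv_dist_rpow_le {α : ℝ} (hα : 2 < α) {ι : Type*} {s : Finset ι} {p : ι → Plane}
    {x : Plane} {D ρ : ℝ} (hD : 0 < D) (hDρ : D ≤ ρ) (hρ : ∀ i ∈ s, ρ ≤ dist (p i) x)
    (hs : ∀ i ∈ s, ∀ j ∈ s, i ≠ j → D ≤ dist (p i) (p j)) :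
    ∑ i ∈ s, 1 / dist (p i) x ^ α ≤ packingConst α * ((ρ / D) ^ 2 / ρ ^ α) := by
  have hρ0 : 0 < ρ := hD.trans_le hDρ
  have hex : ∀ i, ∃ k : ℕ, i ∈ s → ρ * 2 ^ k ≤ dist (p i) x ∧ dist (p i) x < ρ * 2 ^ (k + 1) := by
    intro i
    by_cases hi : i ∈ s
    · obtain ⟨k, h1, h2⟩ := exists_nat_pow_near (x := dist (p i) x / ρ) (y := 2)
        (by rw [le_div_iff₀ hρ0, one_mul]; exact hρ i hi) (by norm_num)
      rw [le_div_iff₀ hρ0] at h1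
      rw [div_lt_iff₀ hρ0] at h2
      exact ⟨k, fun _ => ⟨by linarith, by linarith⟩⟩
    · exact ⟨0, fun h => absurd h hi⟩
  choose g hg using hex
  have hq := two_rpow_two_sub_lt_one hα
  have hq0 : (0 : ℝ) ≤ 2 ^ (2 - α) := by positivity
  -- The ring at distance about `ρ * 2 ^ k` holds at most `49 * (ρ * 2 ^ (k + 1) / D) ^ 2` points,
  -- hence `196 = 49 * 4`; counts grow like `4 ^ k` while terms decay like `2 ^ (-α * k)`.
  set c : ℕ → ℝ := fun k => 196 * ((ρ / D) ^ 2 / ρ ^ α) * ((2 : ℝ) ^ (2 - α)) ^ k with hc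
  have hmain : ∑ i ∈ s, 1 / dist (p i) x ^ α ≤ ∑' k, c k := by
    refine sum_le_tsum_of_fiber_le s _ g c (fun n => by positivity)
      ((summable_geometric_of_lt_one hq0 hq).mul_left _) fun k => ?_
    have hterm : ∀ i ∈ s.filter (g · = k), 1 / dist (p i) x ^ α ≤ 1 / (ρ * 2 ^ k) ^ α := by
      intro i hi
      rw [Finset.mem_filter] at hi
      have := (hg i hi.1).1
      rw [hi.2] at this
      gcongr
    have hcard : ((s.filter (g · = k)).card : ℝ) ≤ 49 * (ρ * 2 ^ (k + 1) / D) ^ 2 := by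
      refine card_le_of_separated (p := p) (x := x) hD ?_ ?_ ?_
      · have : (1 : ℝ) ≤ 2 ^ (k + 1) := one_le_pow₀ (by norm_num)
        nlinarith
      · intro i hi
        rw [Finset.mem_filter] at hi
        have := (hg i hi.1).2
        rw [hi.2] at this
        exact this.le
      · intro i hi j hj
        exact hs i (Finset.mem_filter.1 hi).1 j (Finset.mem_filter.1 hj).1
    refine (Finset.sum_le_card_nsmul _ _ _ hterm).trans ?_
    rw [nsmul_eq_mul]
    calc _ ≤ 49 * (ρ * 2 ^ (k + 1) / D) ^ 2 * (1 / (ρ * 2 ^ k) ^ α) := by gcongr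
      _ = c k := by
        have e1 : ((2 : ℝ) ^ (2 - α)) ^ k = (2 ^ k) ^ 2 / ((2 : ℝ) ^ k) ^ α := by
          rw [← Real.rpow_natCast, ← Real.rpow_mul (by norm_num), ← Real.rpow_natCast 2 k,
            ← Real.rpow_mul (by norm_num), ← Real.rpow_natCast _ 2, ← Real.rpow_mul (by norm_num),
            ← Real.rpow_sub (by norm_num)]
          congr 1; push_cast; ring
        rw [hc]
        simp only
        rw [e1, Real.mul_rpow hρ0.le (by positivity)]
        field_simp
        ring
  refine hmain.trans (le_of_eq ?_)
  rw [hc, tsum_mul_left, tsum_geometric_of_lt_one hq0 hq, packingConst]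
  ring

/-! ### Minimum spanning trees -/

namespace SimpleGraph

/-- Deleting the edge `uv` of a connected graph leaves every vertex joined to `u` or `v`. -/
theorem Connected.reachable_deleteEdges_or {V : Type*} {G : SimpleGraph V} (hG : G.Connected)
    (u v w : V) : (G.deleteEdges {s(u, v)}).Reachable u w ∨
      (G.deleteEdges {s(u, v)}).Reachable v w := by
  obtain ⟨W⟩ := hG.preconnected u w
  have key : ∀ a b : V, G.Walk a b →
      ((G.deleteEdges {s(u, v)}).Reachable u a ∨ (G.deleteEdges {s(u, v)}).Reachable v a) →
      ((G.deleteEdges {s(u, v)}).Reachable u b ∨ (G.deleteEdges {s(u, v)}).Reachable v b) := by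
    intro a b W
    induction W with
    | nil => exact id
    | @cons a c b hac W ih =>
      intro h
      refine ih ?_
      by_cases he : s(a, c) = s(u, v)
      · rcases Sym2.eq_iff.1 he with ⟨-, rfl⟩ | ⟨-, rfl⟩
        · exact Or.inr (Reachable.refl _)
        · exact Or.inl (Reachable.refl _)
      · have hadj : (G.deleteEdges {s(u, v)}).Adj a c := by
          rw [deleteEdges_adj]; exact ⟨hac, he⟩
        exact h.imp (fun h => h.trans hadj.reachable) (fun h => h.trans hadj.reachable)
  exact key u w W (Or.inl (Reachable.refl _))

theorem IsTree.not_reachable_deleteEdges {V : Type*} {G : SimpleGraph V} (hG : G.IsTree)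
    {u v : V} (h : G.Adj u v) : ¬ (G.deleteEdges {s(u, v)}).Reachable u v :=
  isBridge_iff.1 (isAcyclic_iff_forall_adj_isBridge.1 hG.isAcyclic h)

end SimpleGraph

theorem totalLength_sup_edge {R : Finset Plane} {G : SimpleGraph R} {x y : R} (hxy : x ≠ y)
    (h : ¬ G.Adj x y) :
    totalLength (G ⊔ SimpleGraph.edge x y) = dist (x : Plane) y + totalLength G := by
  classical
  have h1 : (Set.toFinite (G ⊔ SimpleGraph.edge x y).edgeSet).toFinset =
      insert s(x, y) (Set.toFinite G.edgeSet).toFinset := by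
    ext e
    have h2 : e = s(x, y) → ¬ e.IsDiag := by rintro rfl; simpa using hxy
    simp only [SimpleGraph.edgeSet_sup, SimpleGraph.edgeSet_edge, Set.Finite.mem_toFinset,
      Set.mem_union, Set.mem_sdiff, Set.mem_singleton_iff, Finset.mem_insert, Sym2.mem_diagSet]
    tauto
  rw [totalLength, h1, Finset.sum_insert (by simpa using h)]
  rfl

open SimpleGraph in
/-- Replacing an edge `uv` of a minimum spanning tree by an edge `xy` that reconnects the two parts
does not shorten the tree. -/
theorem IsMST.dist_le_of_reconnect {R : Finset Plane} {T : SimpleGraph R} (hT : IsMST T)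
    {u v x y : R} (huv : T.Adj u v) (hux : (T.deleteEdges {s(u, v)}).Reachable u x)
    (hvy : (T.deleteEdges {s(u, v)}).Reachable v y) :
    dist (u : Plane) v ≤ dist (x : Plane) y := by
  classical
  set G := T.deleteEdges {s(u, v)} with hG
  have hnot := hT.1.not_reachable_deleteEdges huv
  have hnxy : ¬ G.Reachable x y := fun h => hnot (hux.trans (h.trans hvy.symm))
  have hxy : x ≠ y := fun h => hnxy (h ▸ Reachable.refl _)
  have hxyH : (G ⊔ edge x y).Adj x y := by
    rw [sup_adj]; right; rw [edge_adj]; exact ⟨Or.inl ⟨rfl, rfl⟩, hxy⟩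
  have hGT : G ≤ T := deleteEdges_le _
  have hGH : G ≤ G ⊔ edge x y := le_sup_left
  have huvH : (G ⊔ edge x y).Reachable u v :=
    (hux.mono hGH).trans (hxyH.reachable.trans (hvy.mono hGH).symm)
  have hroot : ∀ w, (G ⊔ edge x y).Reachable u w := fun w =>
    (hT.1.connected.reachable_deleteEdges_or u v w).elim (fun h => h.mono hGH)
      (fun h => huvH.trans (h.mono hGH))
  have hH : (G ⊔ edge x y).IsTree :=
    { preconnected := fun a b => (hroot a).symm.trans (hroot b)
      nonempty := hT.1.connected.nonempty
      isAcyclic := (hT.1.isAcyclic.anti hGT).sup_edge_of_not_reachable hnxy }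
  have hTG : T = G ⊔ edge u v := by
    ext a b
    rw [sup_adj, hG, deleteEdges_adj, edge_adj, Set.mem_singleton_iff, Sym2.eq_iff]
    constructor
    · intro h
      by_cases h' : a = u ∧ b = v ∨ a = v ∧ b = u
      · exact Or.inr ⟨by tauto, h.ne⟩
      · exact Or.inl ⟨h, h'⟩
    · rintro (h | ⟨h | h, -⟩)
      · exact h.1
      · obtain ⟨rfl, rfl⟩ := h; exact huv
      · obtain ⟨rfl, rfl⟩ := h; first | exact huv | exact huv.symm
  have hle := hT.2 _ hH
  have hl : totalLength T = dist (u : Plane) v + totalLength G := by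
    conv_lhs => rw [hTG]
    exact totalLength_sup_edge huv.ne fun h => hnot h.reachable
  rw [hl, totalLength_sup_edge hxy fun h => hnxy h.reachable] at hle
  linarith

open SimpleGraph in
-- Once `uv` is deleted, `u'v'` survives and lies on one side of the cut. If it is the side of `u`,
-- joining `v'` to `v` reconnects the tree; otherwise joining `u` to `u'` does.
theorem IsMST.dist_le_max {R : Finset Plane} {T : SimpleGraph R} (hT : IsMST T)
    {u v u' v' : R} (huv : T.Adj u v) (huv' : T.Adj u' v') (hne : s(u', v') ≠ s(u, v)) :
    dist (u : Plane) v ≤ max (dist (u : Plane) u') (dist (v : Plane) v') := by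
  rcases hT.1.connected.reachable_deleteEdges_or u v u' with h | h
  · have hadj : (T.deleteEdges {s(u, v)}).Adj u' v' := by
      rw [deleteEdges_adj]; exact ⟨huv', hne⟩
    have := hT.dist_le_of_reconnect huv (h.trans hadj.reachable) (Reachable.refl v)
    rw [dist_comm (v' : Plane)] at this
    exact le_max_of_le_right this
  · exact le_max_of_le_left (hT.dist_le_of_reconnect huv (Reachable.refl u) h)

/-- The exchange property of the links of a minimum spanning tree. -/
def ExchangeProperty (S : Finset Link) : Prop :=
  ∀ i ∈ S, ∀ j ∈ S, i ≠ j →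
    i.length ≤ max (dist i.sender j.sender) (dist i.receiver j.receiver)

theorem IsMST.exchangeProperty {R : Finset Plane} {T : SimpleGraph R} {S : Finset Link}
    (hT : IsMST T) (hS : IsOrientation T S) : ExchangeProperty S := by
  intro i hi j hj hij
  obtain ⟨u, v, huv, hiu, hiv⟩ := hS.1 i hi
  obtain ⟨u', v', huv', hju, hjv⟩ := hS.1 j hj
  have hne : s(u', v') ≠ s(u, v) := by
    intro h
    rcases Sym2.eq_iff.1 h with ⟨rfl, rfl⟩ | ⟨rfl, rfl⟩
    · exact hij (Link.ext (hiu.trans hju.symm) (hiv.trans hjv.symm))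
    · rcases hS.2 _ _ huv with h | h
      · exact h.2 ⟨j, hj, hju, hjv⟩
      · exact h.2 ⟨i, hi, hiu, hiv⟩
  rw [Link.length, hiu, hiv, hju, hjv]
  exact hT.dist_le_max huv huv' hne

/-! ### Conflicts between links -/

theorem Link.length_pos (i : Link) : 0 < i.length := dist_pos.2 i.sender_ne_receiver

/-- The least distance between an endpoint of `i` and an endpoint of `j`. -/
noncomputable def linkDist (i j : Link) : ℝ :=
  min (min (dist i.sender j.sender) (dist i.sender j.receiver))
    (min (dist i.receiver j.sender) (dist i.receiver j.receiver))

theorem linkDist_comm (i j : Link) : linkDist i j = linkDist j i := by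
  simp only [linkDist, dist_comm i.sender, dist_comm i.receiver]
  rw [min_min_min_comm]

theorem linkDist_le_sender_sender (i j : Link) : linkDist i j ≤ dist i.sender j.sender :=
  (min_le_left _ _).trans (min_le_left _ _)

theorem linkDist_le_sender_receiver (i j : Link) : linkDist i j ≤ dist i.sender j.receiver :=
  (min_le_left _ _).trans (min_le_right _ _)

theorem linkDist_le_receiver_sender (i j : Link) : linkDist i j ≤ dist i.receiver j.sender :=
  (min_le_right _ _).trans (min_le_left _ _)

theorem linkDist_le_receiver_receiver (i j : Link) : linkDist i j ≤ dist i.receiver j.receiver :=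
  (min_le_right _ _).trans (min_le_right _ _)

/-- Write `a - b` as `‖a‖ - ‖b‖` times the direction of `a`, plus `‖b‖` times the difference of the
directions. This bounds the gap between the far ends of two nearly parallel segments. -/
theorem norm_sub_le_of_direction {E : Type*} [NormedAddCommGroup E] [NormedSpace ℝ E] {a b : E}
    (hb : b ≠ 0) (hba : ‖b‖ ≤ ‖a‖) (h : ‖‖a‖⁻¹ • a - ‖b‖⁻¹ • b‖ ≤ 1 / 2) :
    ‖a - b‖ ≤ ‖a‖ - ‖b‖ / 2 := by
  have hb0 : 0 < ‖b‖ := norm_pos_iff.2 hb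
  have ha0 : 0 < ‖a‖ := hb0.trans_le hba
  have e : a - b = (‖a‖ - ‖b‖) • (‖a‖⁻¹ • a) + ‖b‖ • (‖a‖⁻¹ • a - ‖b‖⁻¹ • b) := by
    rw [smul_sub, smul_inv_smul₀ hb0.ne', sub_smul, smul_inv_smul₀ ha0.ne']
    abel
  have h1 : ‖‖a‖⁻¹ • a‖ = 1 := by
    rw [norm_smul, norm_inv, norm_norm, inv_mul_cancel₀ ha0.ne']
  rw [e]
  refine (norm_add_le _ _).trans ?_
  rw [norm_smul _ (‖a‖⁻¹ • a), h1, norm_smul ‖b‖, Real.norm_of_nonneg (by linarith), norm_norm]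
  nlinarith

/-- Segments of length at least `m` with one end near a point, none of which can be
exchanged for a shorter connection, are bounded in number. -/
theorem card_le_of_exchange {ι : Type*} {J : Finset ι} {u v : ι → Plane} {x : Plane} {c m : ℝ}
    (hm : 0 < m) (hlen : ∀ j ∈ J, m ≤ dist (u j) (v j)) (hx : ∀ j ∈ J, dist (u j) x ≤ c * m)
    (hex : ∀ j ∈ J, ∀ k ∈ J, j ≠ k →
      dist (u j) (v j) ≤ max (dist (u j) (u k)) (dist (v j) (v k))) :
    J.card ≤ (2 * ⌈4 * c⌉₊ + 1) ^ 2 * 81 := by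
  set n := ⌈4 * c⌉₊
  have h81 : (81 : ℕ) = (2 * 4 + 1) ^ 2 := by norm_num
  rw [h81, ← card_grid, ← card_grid, ← Finset.card_product]
  have hne : ∀ j ∈ J, 0 < ‖v j - u j‖ := fun j hj => by
    rw [← dist_eq_norm, dist_comm]; exact hm.trans_le (hlen j hj)
  -- Pigeonhole on the cell of the near end and the cell of the unit direction; the latter gives the
  -- factor `81`.
  refine Finset.card_le_card_of_injOn (fun j => (gridCell (m / 4) (u j - x),
    gridCell (1 / 4) (‖v j - u j‖⁻¹ • (v j - u j)))) ?_ ?_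
  · intro j hj
    refine Finset.mem_product.2 ⟨gridCell_mem (by positivity) ?_, gridCell_mem (by norm_num) ?_⟩
    · rw [← dist_eq_norm]
      have := Nat.le_ceil (4 * c)
      have := hx j hj
      nlinarith
    · rw [norm_smul, norm_inv, norm_norm, inv_mul_cancel₀ (hne j hj).ne']
      norm_num
  -- Let `j` be the longer of two segments that share both cells. The near ends are within `m / 2`,
  -- and the far ends within less than (length of `j`) `- m / 2 + m / 2`, so both beat the exchange
  -- bound for `j`.
  · have key : ∀ j ∈ J, ∀ k ∈ J, dist (u j) (u k) < m / 2 →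
        ‖‖v j - u j‖⁻¹ • (v j - u j) - ‖v k - u k‖⁻¹ • (v k - u k)‖ ≤ 1 / 2 →
        ‖v k - u k‖ ≤ ‖v j - u j‖ → j = k := by
      intro j hj k hk hu hd hle
      by_contra hjk
      have h1 := norm_sub_le_of_direction (norm_pos_iff.1 (hne k hk)) hle hd
      have hlj := hlen j hj
      have hlk := hlen k hk
      rw [dist_comm, dist_eq_norm] at hlj hlk
      have h2 : dist (v j) (v k) ≤ ‖(v j - u j) - (v k - u k)‖ + dist (u j) (u k) := by
        rw [dist_eq_norm, dist_eq_norm]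
        refine le_trans (le_of_eq ?_) (norm_add_le _ _)
        congr 1; abel
      have h3 := hex j hj k hk hjk
      rw [dist_comm (u j) (v j), dist_eq_norm (v j) (u j), le_max_iff] at h3
      rcases h3 with h3 | h3 <;> linarith
    intro j hj k hk hjk
    simp only [Prod.mk.injEq] at hjk
    have hu := dist_lt_of_gridCell_eq (by positivity) hjk.1
    have hd := dist_lt_of_gridCell_eq (by positivity) hjk.2
    rw [dist_sub_right] at hu
    rw [dist_eq_norm] at hd
    rcases le_total ‖v k - u k‖ ‖v j - u j‖ with h | h
    · exact key j hj k hk (by linarith) (by linarith) h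
    · refine (key k hk j hj (by rw [dist_comm]; linarith) ?_ h).symm
      rw [norm_sub_rev]; linarith

/-- A bound for the number of links of length at least `m` at distance at most `c * m`. -/
noncomputable def nearConst (c : ℝ) : ℕ := 4 * ((2 * ⌈4 * c⌉₊ + 1) ^ 2 * 81)

/-- One of four pairs of endpoints realises `linkDist`. Each pair is a case of
`card_le_of_exchange`, whose exchange hypothesis is unchanged when senders and receivers are
swapped. -/
theorem ExchangeProperty.card_near_le {S : Finset Link} (hS : ExchangeProperty S) (i : Link)
    {c m : ℝ} (hm : 0 < m) :
    (S.filter fun j => m ≤ j.length ∧ linkDist i j ≤ c * m).card ≤ nearConst c := by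
  have hs : ∀ x : Plane, (S.filter fun j => m ≤ j.length ∧ dist j.sender x ≤ c * m).card ≤
      (2 * ⌈4 * c⌉₊ + 1) ^ 2 * 81 := by
    intro x
    refine card_le_of_exchange (u := Link.sender) (v := Link.receiver) (x := x) hm ?_ ?_ ?_
    · exact fun j hj => (Finset.mem_filter.1 hj).2.1
    · exact fun j hj => (Finset.mem_filter.1 hj).2.2
    · exact fun j hj k hk => hS j (Finset.mem_filter.1 hj).1 k (Finset.mem_filter.1 hk).1
  have hr : ∀ x : Plane, (S.filter fun j => m ≤ j.length ∧ dist j.receiver x ≤ c * m).card ≤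
      (2 * ⌈4 * c⌉₊ + 1) ^ 2 * 81 := by
    intro x
    refine card_le_of_exchange (u := Link.receiver) (v := Link.sender) (x := x) hm ?_ ?_ ?_
    · exact fun j hj => (Finset.mem_filter.1 hj).2.1.trans_eq (dist_comm _ _)
    · exact fun j hj => (Finset.mem_filter.1 hj).2.2
    · intro j hj k hk hjk
      rw [dist_comm, max_comm]
      exact hS j (Finset.mem_filter.1 hj).1 k (Finset.mem_filter.1 hk).1 hjk
  have hsub : (S.filter fun j => m ≤ j.length ∧ linkDist i j ≤ c * m) ⊆
      ((S.filter fun j => m ≤ j.length ∧ dist j.sender i.sender ≤ c * m) ∪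
        (S.filter fun j => m ≤ j.length ∧ dist j.receiver i.sender ≤ c * m)) ∪
      ((S.filter fun j => m ≤ j.length ∧ dist j.sender i.receiver ≤ c * m) ∪
        (S.filter fun j => m ≤ j.length ∧ dist j.receiver i.receiver ≤ c * m)) := by
    intro j hj
    simp only [linkDist, min_le_iff, Finset.mem_filter, dist_comm i.sender,
      dist_comm i.receiver] at hj
    simp only [Finset.mem_union, Finset.mem_filter]
    tauto
  refine (Finset.card_le_card hsub).trans ?_
  refine (Finset.card_union_le _ _).trans ?_
  have h1 := (Finset.card_union_le (S.filter fun j => m ≤ j.length ∧ dist j.sender i.sender ≤ c * m)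
    (S.filter fun j => m ≤ j.length ∧ dist j.receiver i.sender ≤ c * m))
  have h2 := (Finset.card_union_le
    (S.filter fun j => m ≤ j.length ∧ dist j.sender i.receiver ≤ c * m)
    (S.filter fun j => m ≤ j.length ∧ dist j.receiver i.receiver ≤ c * m))
  have := hs i.sender
  have := hs i.receiver
  have := hr i.sender
  have := hr i.receiver
  unfold nearConst
  omega

/-! ### Greedy colouring -/

/-- Elements are coloured in order of decreasing `f`: the induction inserts a minimum last, so only
conflicts with elements of at least the same value block a colour. -/
theorem exists_greedy_coloring {ι : Type*} [DecidableEq ι] (s : Finset ι) (f : ι → ℝ)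
    (r : ι → ι → Prop) [DecidableRel r] (hr : ∀ i j, r i j → r j i) (m : ℕ)
    (h : ∀ i ∈ s, (s.filter fun j => f i ≤ f j ∧ j ≠ i ∧ r i j).card ≤ m) :
    ∃ c : ι → Fin (m + 1), ∀ i ∈ s, ∀ j ∈ s, i ≠ j → r i j → c i ≠ c j := by
  induction s using Finset.induction_on_min_value f with
  | empty => exact ⟨fun _ => 0, by simp⟩
  | insert a s ha hmin ih =>
    obtain ⟨c, hc⟩ := ih fun i hi => (Finset.card_le_card
      (Finset.filter_subset_filter _ (Finset.subset_insert a s))).trans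
        (h i (Finset.mem_insert_of_mem hi))
    have hlt : ((s.filter (r a ·)).image c).card < (Finset.univ : Finset (Fin (m + 1))).card := by
      rw [Finset.card_univ, Fintype.card_fin]
      refine Nat.lt_succ_of_le (Finset.card_image_le.trans (le_trans (Finset.card_le_card ?_)
        (h a (Finset.mem_insert_self a s))))
      intro j hj
      rw [Finset.mem_filter] at hj ⊢
      exact ⟨Finset.mem_insert_of_mem hj.1, hmin j hj.1, fun e => ha (e ▸ hj.1), hj.2⟩
    obtain ⟨k, -, hk⟩ := Finset.exists_mem_notMem_of_card_lt_card hlt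
    have hk' : ∀ j ∈ s, r a j → k ≠ c j := fun j hj hrj e =>
      hk (Finset.mem_image.2 ⟨j, Finset.mem_filter.2 ⟨hj, hrj⟩, e.symm⟩)
    have hne : ∀ i ∈ s, i ≠ a := fun i hi e => ha (e ▸ hi)
    refine ⟨Function.update c a k, ?_⟩
    intro i hi j hj hij hrij
    rcases Finset.mem_insert.1 hi with rfl | hi' <;> rcases Finset.mem_insert.1 hj with rfl | hj'
    · exact absurd rfl hij
    · rw [Function.update_self, Function.update_of_ne hij.symm]
      exact hk' j hj' hrij
    · rw [Function.update_self, Function.update_of_ne hij]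
      exact (hk' i hi' (hr _ _ hrij)).symm
    · rw [Function.update_of_ne (hne i hi'), Function.update_of_ne (hne j hj')]
      exact hc i hi' j hj' hij hrij

theorem exists_finpartition_of_coloring {ι : Type*} [DecidableEq ι] (s : Finset ι) {n : ℕ}
    (c : ι → Fin n) : ∃ P : Finpartition s, P.parts.card ≤ n ∧
      ∀ A ∈ P.parts, A ⊆ s ∧ ∀ i ∈ A, ∀ j ∈ A, c i = c j := by
  -- Parts of a `Finpartition` are nonempty, so unused colours are erased.
  refine ⟨Finpartition.ofErase (Finset.univ.image fun k => s.filter (c · = k)) ?_ ?_, ?_, ?_⟩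
  · rw [Finset.supIndep_iff_pairwiseDisjoint]
    intro A hA B hB hAB
    simp only [Finset.coe_image, Finset.coe_univ, Set.image_univ, Set.mem_range] at hA hB
    obtain ⟨k, rfl⟩ := hA
    obtain ⟨l, rfl⟩ := hB
    refine Finset.disjoint_left.2 fun i hi hi' => hAB ?_
    rw [← (Finset.mem_filter.1 hi).2, ← (Finset.mem_filter.1 hi').2]
  · ext i
    simp [Finset.mem_sup]
  · exact (Finset.card_le_card (Finset.erase_subset _ _)).trans
      (Finset.card_image_le.trans (by simp))
  · intro A hA
    have hA' := Finset.mem_of_mem_erase hA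
    simp only [Finset.mem_image, Finset.mem_univ, true_and] at hA'
    obtain ⟨k, rfl⟩ := hA'
    refine ⟨Finset.filter_subset _ _, fun i hi j hj => ?_⟩
    rw [(Finset.mem_filter.1 hi).2, (Finset.mem_filter.1 hj).2]

/-! ### Independent sets of links -/

/-- The distance of any two links is large compared with the length of the shorter one, in terms of
a function `φ` of the ratio of the lengths. -/
def IsIndependent (γ : ℝ) (φ : ℝ → ℝ) (A : Finset Link) : Prop :=
  ∀ i ∈ A, ∀ j ∈ A, i ≠ j → i.length ≤ j.length →
    γ * i.length * φ (j.length / i.length) < linkDist i j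

theorem div_length_le_lengthDiversity {S : Finset Link} {i j : Link} (hi : i ∈ S) (hj : j ∈ S) :
    j.length / i.length ≤ lengthDiversity S := by
  have hne : S.Nonempty := ⟨i, hi⟩
  rw [lengthDiversity, dif_pos hne]
  have h1 : 0 < S.inf' hne Link.length := by
    rw [Finset.lt_inf'_iff]; exact fun k _ => k.length_pos
  have h2 := Finset.le_sup' Link.length hj
  have h3 := Finset.inf'_le Link.length hi
  exact div_le_div₀ (j.length_pos.le.trans h2) h2 h1 h3

/-- If the possible length ratios are covered by intervals `[a k, b k]` with `φ (b k) ≤ B * a k`,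
then the links split into `O(#ι)` independent sets. -/
theorem ExchangeProperty.exists_independent_partition {S : Finset Link} (hS : ExchangeProperty S)
    {γ B : ℝ} (hγ : 0 ≤ γ) {φ : ℝ → ℝ} (hφ : ∀ x y, 1 ≤ x → x ≤ y → φ x ≤ φ y)
    {ι : Type*} [Fintype ι] (a b : ι → ℝ) (ha : ∀ k, 0 < a k) (hab : ∀ k, φ (b k) ≤ B * a k)
    (hcover : ∀ y, 1 ≤ y → y ≤ lengthDiversity S → ∃ k, a k ≤ y ∧ y ≤ b k) :
    ∃ P : Finpartition S, (∀ A ∈ P.parts, IsIndependent γ φ A) ∧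
      P.parts.card ≤ Fintype.card ι * nearConst (γ * B) + 1 := by
  classical
  let r : Link → Link → Prop := fun i j => linkDist i j ≤ γ * min i.length j.length *
    φ (max i.length j.length / min i.length j.length)
  have hr : ∀ i j, r i j → r j i := by
    intro i j h
    simp only [r] at h ⊢
    rwa [linkDist_comm, min_comm, max_comm]
  obtain ⟨c, hc⟩ := exists_greedy_coloring S Link.length r hr
    (Fintype.card ι * nearConst (γ * B)) <| by
    intro i hi
    -- If the ratio lies in `[a k, b k]`, then `φ (b k) ≤ B * a k` puts a conflicting `j` within `γ
    -- * B` times the scale `a k * i.length`, and `j` is at least as long as that scale.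
    have hsub : (S.filter fun j => i.length ≤ j.length ∧ j ≠ i ∧ r i j) ⊆
        Finset.univ.biUnion fun k => S.filter fun j => a k * i.length ≤ j.length ∧
          linkDist i j ≤ γ * B * (a k * i.length) := by
      intro j hj
      obtain ⟨hj, hij, -, hrij⟩ := Finset.mem_filter.1 hj
      have hi0 := i.length_pos
      simp only [r, min_eq_left hij, max_eq_right hij] at hrij
      have h1 : 1 ≤ j.length / i.length := by rwa [le_div_iff₀ hi0, one_mul]
      obtain ⟨k, hak, hkb⟩ := hcover _ h1 (div_length_le_lengthDiversity hi hj)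
      simp only [Finset.mem_biUnion, Finset.mem_univ, true_and, Finset.mem_filter]
      refine ⟨k, hj, (le_div_iff₀ hi0).1 hak, hrij.trans ?_⟩
      have h2 := (hφ _ _ h1 hkb).trans (hab k)
      calc _ ≤ γ * i.length * (B * a k) := by gcongr
        _ = _ := by ring
    refine (Finset.card_le_card hsub).trans (Finset.card_biUnion_le.trans ?_)
    refine (Finset.sum_le_card_nsmul _ _ _ fun k _ =>
      hS.card_near_le i (mul_pos (ha k) i.length_pos)).trans ?_
    simp
  obtain ⟨P, hP, hPc⟩ := exists_finpartition_of_coloring S c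
  refine ⟨P, fun A hA i hi j hj hij hle => ?_, hP⟩
  obtain ⟨hAS, hcA⟩ := hPc A hA
  by_contra hcon
  refine hc i (hAS hi) j (hAS hj) hij ?_ (hcA i hi j hj)
  simp only [r, min_eq_left hle, max_eq_right hle]
  exact not_lt.1 hcon

/-! ### Weighted sums over independent sets -/

/-- The contribution of the links of length about `l / q` to a weighted sum at a link of length `l`:
separation `γ * l / (2 * q)`, exclusion radius `f` times larger. The result does not depend on `l`.
-/
theorem rpow_weight_eq {l q f γ α τ : ℝ} (hl : 0 < l) (hq : 0 < q) (hf : 0 < f) (hγ : 0 < γ) :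
    (l / q) ^ (τ * α) * l ^ ((1 - τ) * α) * (f ^ 2 / (γ * (l / (2 * q)) * f) ^ α) =
      (2 / γ) ^ α * (q ^ (α * (1 - τ)) * f ^ (2 - α)) := by
  have e1 : l ^ α = l ^ (τ * α) * l ^ ((1 - τ) * α) := by
    rw [← Real.rpow_add hl]; congr 1; ring
  have e2 : q ^ α = q ^ (τ * α) * q ^ (α * (1 - τ)) := by
    rw [← Real.rpow_add hq]; congr 1; ring
  have e3 : f ^ (2 - α) = f ^ 2 / f ^ α := by
    rw [Real.rpow_sub hf, Real.rpow_two]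
  rw [Real.mul_rpow (by positivity) hf.le, Real.mul_rpow hγ.le (by positivity),
    Real.div_rpow hl.le (by positivity : 0 ≤ 2 * q), Real.div_rpow hl.le hq.le,
    Real.mul_rpow (by norm_num) hq.le, Real.div_rpow (by norm_num : (0 : ℝ) ≤ 2) hγ.le, e1, e2, e3]
  field_simp

theorem IsIndependent.le_linkDist {γ : ℝ} {φ : ℝ → ℝ} {A : Finset Link} (hA : IsIndependent γ φ A)
    (hγ : 0 < γ) (hφ1 : ∀ x, 1 ≤ x → 1 ≤ φ x) {i j : Link} (hi : i ∈ A) (hj : j ∈ A) (hij : i ≠ j)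
    {m : ℝ} (hmi : m ≤ i.length) (hmj : m ≤ j.length) : γ * m ≤ linkDist i j := by
  have key : ∀ i ∈ A, ∀ j ∈ A, i ≠ j → i.length ≤ j.length → m ≤ i.length →
      γ * m ≤ linkDist i j := by
    intro i hi j hj hij hle hm
    refine le_trans ?_ (hA i hi j hj hij hle).le
    have h1 := hφ1 (j.length / i.length) (by rwa [le_div_iff₀ i.length_pos, one_mul])
    have h2 := mul_pos hγ i.length_pos
    nlinarith
  rcases le_total i.length j.length with h | h
  · exact key i hi j hj hij h hmi
  · rw [linkDist_comm]; exact key j hj i hi hij.symm h hmj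

/-- Links of length between `l / 2 ^ (t + 1)` and `l / 2 ^ t`, with `l = i.length`, are mutually
separated on that scale and are kept farther from `i` by the factor `φ (2 ^ t)`, so the packing
bound applies to each class. Leaving `e` and `x` free serves both senders seen from a receiver and
receivers seen from a sender. -/
theorem IsIndependent.sum_short_le {α γ : ℝ} (hα : 2 < α) (hγ : 0 < γ) {φ : ℝ → ℝ}
    (hφ : ∀ x y, 1 ≤ x → x ≤ y → φ x ≤ φ y) (hφ1 : ∀ x, 1 ≤ x → 1 ≤ φ x) {A : Finset Link}
    (hA : IsIndependent γ φ A) {i : Link} (hi : i ∈ A) {e : Link → Plane} {x : Plane}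
    (he : ∀ k k', linkDist k k' ≤ dist (e k) (e k')) (hx : ∀ k, linkDist k i ≤ dist (e k) x)
    {τ : ℝ} (hτ : 0 ≤ τ)
    (hsum : Summable fun t : ℕ => ((2 : ℝ) ^ t) ^ (α * (1 - τ)) * φ (2 ^ t) ^ (2 - α)) :
    ∑ k ∈ A with k ≠ i ∧ k.length ≤ i.length,
        k.length ^ (τ * α) * i.length ^ ((1 - τ) * α) * (1 / dist (e k) x ^ α) ≤
      packingConst α * (2 / γ) ^ α *
        ∑' t : ℕ, ((2 : ℝ) ^ t) ^ (α * (1 - τ)) * φ (2 ^ t) ^ (2 - α) := by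
  have hC := packingConst_pos hα
  have hi0 := i.length_pos
  have hex : ∀ k : Link, ∃ t : ℕ, k.length ≤ i.length →
      k.length ≤ i.length / 2 ^ t ∧ i.length / (2 * 2 ^ t) ≤ k.length := by
    intro k
    by_cases hk : k.length ≤ i.length
    · obtain ⟨t, h1, h2⟩ := exists_nat_pow_near (x := i.length / k.length) (y := 2)
        (by rwa [le_div_iff₀ k.length_pos, one_mul]) (by norm_num)
      rw [le_div_iff₀ k.length_pos] at h1
      rw [div_lt_iff₀ k.length_pos, pow_succ] at h2
      refine ⟨t, fun _ => ⟨?_, ?_⟩⟩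
      · rw [le_div_iff₀ (by positivity)]; linarith
      · rw [div_le_iff₀ (by positivity)]; linarith
    · exact ⟨0, fun h => absurd h hk⟩
  choose g hg using hex
  have hpow : ∀ t : ℕ, (1 : ℝ) ≤ 2 ^ t := fun t => one_le_pow₀ (by norm_num)
  have hf1 : ∀ t : ℕ, 1 ≤ φ (2 ^ t) := fun t => hφ1 _ (hpow t)
  rw [← tsum_mul_left]
  refine sum_le_tsum_of_fiber_le _ _ g _ (fun t => ?_) (hsum.mul_left _) fun t => ?_
  · have := hf1 t
    positivity
  have hf := hf1 t
  set F := (A.filter fun k => k ≠ i ∧ k.length ≤ i.length).filter (g · = t) with hF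
  have hFm : ∀ k ∈ F, k ∈ A ∧ k ≠ i ∧ k.length ≤ i.length / 2 ^ t ∧
      i.length / (2 * 2 ^ t) ≤ k.length := by
    intro k hk
    simp only [hF, Finset.mem_filter] at hk
    have := hg k hk.1.2.2
    rw [hk.2] at this
    exact ⟨hk.1.1, hk.1.2.1, this⟩
  have hD : 0 < γ * (i.length / (2 * 2 ^ t)) := by positivity
  have hpack := sum_inv_dist_rpow_le hα (s := F) (p := e) (x := x) hD
    (ρ := γ * (i.length / (2 * 2 ^ t)) * φ (2 ^ t)) (le_mul_of_one_le_right hD.le hf) ?_ ?_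
  · rw [mul_div_cancel_left₀ _ hD.ne'] at hpack
    calc _ ≤ ∑ k ∈ F, (i.length / 2 ^ t) ^ (τ * α) * i.length ^ ((1 - τ) * α) *
          (1 / dist (e k) x ^ α) := by
          refine Finset.sum_le_sum fun k hk => ?_
          have h1 := (hFm k hk).2.2.1
          have h2 := k.length_pos
          have h3 : 0 ≤ τ * α := by nlinarith
          gcongr
      _ ≤ (i.length / 2 ^ t) ^ (τ * α) * i.length ^ ((1 - τ) * α) *
          (packingConst α * (φ (2 ^ t) ^ 2 /
            (γ * (i.length / (2 * 2 ^ t)) * φ (2 ^ t)) ^ α)) := by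
          rw [← Finset.mul_sum]
          gcongr
      _ = _ := by
          rw [mul_left_comm, rpow_weight_eq hi0 (by positivity) (by linarith) hγ]
          ring
  · intro k hk
    obtain ⟨hkA, hki, h1, h2⟩ := hFm k hk
    have hk0 := k.length_pos
    have hle : k.length ≤ i.length := h1.trans (div_le_self hi0.le (hpow t))
    have h3 : φ (2 ^ t) ≤ φ (i.length / k.length) := by
      refine hφ _ _ (hpow t) ?_
      rw [le_div_iff₀ (by positivity)] at h1
      rw [le_div_iff₀ hk0]; linarith
    refine le_trans ?_ ((hA k hkA i hi hki hle).le.trans (hx k))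
    gcongr
  · intro k hk k' hk' hne
    obtain ⟨hkA, -, -, h2⟩ := hFm k hk
    obtain ⟨hkA', -, -, h2'⟩ := hFm k' hk'
    exact (hA.le_linkDist hγ hφ1 hkA hkA' hne h2 h2').trans (he k k')

/-- Here classes have length about `2 ^ t * i.length`. Since `φ x ≤ x`, the exclusion radius `γ *
i.length * φ (2 ^ t)` is also a valid separation, which leaves only its power `-α`. -/
theorem IsIndependent.sum_long_le {α γ : ℝ} (hα : 2 < α) (hγ : 0 < γ) {φ : ℝ → ℝ}
    (hφ : ∀ x y, 1 ≤ x → x ≤ y → φ x ≤ φ y) (hφ1 : ∀ x, 1 ≤ x → 1 ≤ φ x)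
    (hφx : ∀ x, 1 ≤ x → φ x ≤ x) {A : Finset Link}
    (hA : IsIndependent γ φ A) {i : Link} (hi : i ∈ A) {e : Link → Plane} {x : Plane}
    (he : ∀ k k', linkDist k k' ≤ dist (e k) (e k')) (hx : ∀ k, linkDist k i ≤ dist (e k) x)
    {τ : ℝ} (hτ : 0 ≤ τ)
    (hsum : Summable fun t : ℕ => ((2 : ℝ) ^ t) ^ (τ * α) * φ (2 ^ t) ^ (-α)) :
    ∑ k ∈ A with k ≠ i ∧ i.length ≤ k.length,
        k.length ^ (τ * α) * i.length ^ ((1 - τ) * α) * (1 / dist (e k) x ^ α) ≤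
      packingConst α * (2 ^ (τ * α) / γ ^ α) *
        ∑' t : ℕ, ((2 : ℝ) ^ t) ^ (τ * α) * φ (2 ^ t) ^ (-α) := by
  have hC := packingConst_pos hα
  have hi0 := i.length_pos
  have hex : ∀ k : Link, ∃ t : ℕ, i.length ≤ k.length →
      2 ^ t * i.length ≤ k.length ∧ k.length ≤ 2 * 2 ^ t * i.length := by
    intro k
    by_cases hk : i.length ≤ k.length
    · obtain ⟨t, h1, h2⟩ := exists_nat_pow_near (x := k.length / i.length) (y := 2)
        (by rwa [le_div_iff₀ hi0, one_mul]) (by norm_num)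
      rw [le_div_iff₀ hi0] at h1
      rw [div_lt_iff₀ hi0, pow_succ] at h2
      exact ⟨t, fun _ => ⟨h1, by linarith⟩⟩
    · exact ⟨0, fun h => absurd h hk⟩
  choose g hg using hex
  have hpow : ∀ t : ℕ, (1 : ℝ) ≤ 2 ^ t := fun t => one_le_pow₀ (by norm_num)
  have hf1 : ∀ t : ℕ, 1 ≤ φ (2 ^ t) := fun t => hφ1 _ (hpow t)
  rw [← tsum_mul_left]
  refine sum_le_tsum_of_fiber_le _ _ g _ (fun t => ?_) (hsum.mul_left _) fun t => ?_
  · have := hf1 t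
    positivity
  have hf := hf1 t
  set F := (A.filter fun k => k ≠ i ∧ i.length ≤ k.length).filter (g · = t) with hF
  have hFm : ∀ k ∈ F, k ∈ A ∧ k ≠ i ∧ 2 ^ t * i.length ≤ k.length ∧
      k.length ≤ 2 * 2 ^ t * i.length := by
    intro k hk
    simp only [hF, Finset.mem_filter] at hk
    have := hg k hk.1.2.2
    rw [hk.2] at this
    exact ⟨hk.1.1, hk.1.2.1, this⟩
  have hρ : 0 < γ * i.length * φ (2 ^ t) := by positivity
  have hpack := sum_inv_dist_rpow_le hα (s := F) (p := e) (x := x) hρ le_rfl ?_ ?_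
  · rw [div_self hρ.ne'] at hpack
    calc _ ≤ ∑ k ∈ F, (2 * 2 ^ t * i.length) ^ (τ * α) * i.length ^ ((1 - τ) * α) *
          (1 / dist (e k) x ^ α) := by
          refine Finset.sum_le_sum fun k hk => ?_
          have h1 := (hFm k hk).2.2.2
          have h2 := k.length_pos
          have h3 : 0 ≤ τ * α := by nlinarith
          gcongr
      _ ≤ (2 * 2 ^ t * i.length) ^ (τ * α) * i.length ^ ((1 - τ) * α) *
          (packingConst α * (1 ^ 2 / (γ * i.length * φ (2 ^ t)) ^ α)) := by
          rw [← Finset.mul_sum]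
          gcongr
      _ = _ := by
          have e1 : i.length ^ α = i.length ^ (τ * α) * i.length ^ ((1 - τ) * α) := by
            rw [← Real.rpow_add hi0]; congr 1; ring
          rw [Real.rpow_neg (by linarith), Real.mul_rpow (by positivity) hi0.le,
            Real.mul_rpow (by norm_num) (by positivity), Real.mul_rpow (by positivity) (by linarith),
            Real.mul_rpow hγ.le hi0.le, e1]
          field_simp
  · intro k hk
    obtain ⟨hkA, hki, h1, h2⟩ := hFm k hk
    have hle : i.length ≤ k.length := (le_mul_of_one_le_left hi0.le (hpow t)).trans h1
    have h3 : φ (2 ^ t) ≤ φ (k.length / i.length) :=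
      hφ _ _ (hpow t) (by rwa [le_div_iff₀ hi0])
    refine le_trans ?_ ((hA i hi k hkA hki.symm hle).le.trans ((linkDist_comm i k).le.trans (hx k)))
    gcongr
  · intro k hk k' hk' hne
    obtain ⟨hkA, -, h2, -⟩ := hFm k hk
    obtain ⟨hkA', -, h2', -⟩ := hFm k' hk'
    refine le_trans ?_ ((hA.le_linkDist hγ hφ1 hkA hkA' hne h2 h2').trans (he k k'))
    have := hφx _ (hpow t)
    rw [mul_assoc, mul_comm i.length]
    gcongr

theorem exists_large_scale {α c η : ℝ} (hα : 0 < α) (hη : 0 < η) :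
    ∃ γ : ℝ, 1 ≤ γ ∧ c / γ ^ α ≤ η := by
  obtain ⟨γ, h1, h2⟩ := ((Filter.eventually_ge_atTop (1 : ℝ)).and
    ((tendsto_rpow_atTop hα).eventually_ge_atTop (c / η))).exists
  refine ⟨γ, h1, ?_⟩
  rw [div_le_iff₀ hη] at h2
  rw [div_le_iff₀ (by positivity)]
  linarith

/-! ### Oblivious power -/

theorem summable_two_pow_rpow {c : ℝ} (hc : c < 0) : Summable fun t : ℕ => ((2 : ℝ) ^ t) ^ c := by
  have h : ∀ t : ℕ, ((2 : ℝ) ^ t) ^ c = ((2 : ℝ) ^ c) ^ t := fun t => by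
    rw [← Real.rpow_natCast, ← Real.rpow_natCast, ← Real.rpow_mul (by norm_num),
      ← Real.rpow_mul (by norm_num), mul_comm]
  simp_rw [h]
  exact summable_geometric_of_lt_one (by positivity)
    (Real.rpow_lt_one_of_one_lt_of_neg (by norm_num) hc)

/-- The two exponent hypotheses are exactly the convergence conditions: `α * (1 - τ) < δ * (α - 2)`
for shorter links and `τ < δ` for longer ones. A large `γ` then makes both sums small. -/
theorem exists_sum_oblivious_le {α τ δ η : ℝ} (hα : 2 < α) (hτ : 0 ≤ τ) (hτδ : τ < δ) (hδ : δ ≤ 1)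
    (hτδα : α * (1 - τ) < δ * (α - 2)) (hη : 0 < η) :
    ∃ γ : ℝ, 1 ≤ γ ∧ ∀ A : Finset Link, IsIndependent γ (fun x => x ^ δ) A → ∀ i ∈ A,
      ∑ k ∈ A.erase i, k.length ^ (τ * α) * i.length ^ ((1 - τ) * α) *
        (1 / dist k.sender i.receiver ^ α) ≤ η := by
  have hδ0 : 0 < δ := hτ.trans_lt hτδ
  have hcomb : ∀ a b : ℝ, ∀ t : ℕ, ((2 : ℝ) ^ t) ^ a * (((2 : ℝ) ^ t) ^ δ) ^ b =
      ((2 : ℝ) ^ t) ^ (a + δ * b) := fun a b t => by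
    rw [← Real.rpow_mul (by positivity), ← Real.rpow_add (by positivity)]
  have hs1 : Summable fun t : ℕ =>
      ((2 : ℝ) ^ t) ^ (α * (1 - τ)) * (((2 : ℝ) ^ t) ^ δ) ^ (2 - α) := by
    simp_rw [hcomb]; exact summable_two_pow_rpow (by linarith)
  have hs2 : Summable fun t : ℕ => ((2 : ℝ) ^ t) ^ (τ * α) * (((2 : ℝ) ^ t) ^ δ) ^ (-α) := by
    simp_rw [hcomb]; exact summable_two_pow_rpow (by nlinarith)
  obtain ⟨γ, hγ1, hγ⟩ := exists_large_scale (α := α) (η := η) (by linarith) hη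
    (c := packingConst α * 2 ^ α *
        ∑' t : ℕ, ((2 : ℝ) ^ t) ^ (α * (1 - τ)) * (((2 : ℝ) ^ t) ^ δ) ^ (2 - α) +
      packingConst α * 2 ^ (τ * α) *
        ∑' t : ℕ, ((2 : ℝ) ^ t) ^ (τ * α) * (((2 : ℝ) ^ t) ^ δ) ^ (-α))
  refine ⟨γ, hγ1, fun A hA i hi => ?_⟩
  have hγ0 : 0 < γ := by linarith
  have hφ : ∀ x y : ℝ, 1 ≤ x → x ≤ y → x ^ δ ≤ y ^ δ := fun x y hx hxy => by gcongr
  have hφ1 : ∀ x : ℝ, 1 ≤ x → 1 ≤ x ^ δ := fun x hx => Real.one_le_rpow hx hδ0.le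
  have hφx : ∀ x : ℝ, 1 ≤ x → x ^ δ ≤ x := fun x hx => Real.rpow_le_self_of_one_le hx hδ
  have h1 := hA.sum_short_le hα hγ0 hφ hφ1 hi (e := Link.sender) (x := i.receiver)
    linkDist_le_sender_sender (fun k => linkDist_le_sender_receiver k i) hτ hs1
  have h2 := hA.sum_long_le hα hγ0 hφ hφ1 hφx hi (e := Link.sender) (x := i.receiver)
    linkDist_le_sender_sender (fun k => linkDist_le_sender_receiver k i) hτ hs2
  have hsub : A.erase i ⊆ (A.filter fun k => k ≠ i ∧ k.length ≤ i.length) ∪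
      (A.filter fun k => k ≠ i ∧ i.length ≤ k.length) := by
    intro k hk
    have := le_total k.length i.length
    simp only [Finset.mem_erase, Finset.mem_union, Finset.mem_filter] at hk ⊢
    tauto
  have hnn : ∀ k : Link, 0 ≤ k.length ^ (τ * α) * i.length ^ ((1 - τ) * α) *
      (1 / dist k.sender i.receiver ^ α) := fun k => by
    have := k.length_pos; have := i.length_pos; positivity
  refine (Finset.sum_le_sum_of_subset_of_nonneg hsub fun k _ _ => hnn k).trans ?_
  refine le_trans ?_ hγ
  rw [Real.div_rpow (by norm_num) hγ0.le] at h1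
  refine le_trans (le_trans ?_ (add_le_add h1 h2)) (le_of_eq (by ring))
  rw [← Finset.sum_union_inter]
  exact le_add_of_nonneg_right (Finset.sum_nonneg fun k _ => hnn k)

theorem exists_independent_isPFeasible_oblivious {α τ δ β ε : ℝ} (hα : 2 < α) (hτ : 0 ≤ τ)
    (hτδ : τ < δ) (hδ : δ ≤ 1) (hτδα : α * (1 - τ) < δ * (α - 2)) (hβ : 0 < β) (hε : 0 < ε) :
    ∃ γ : ℝ, 1 ≤ γ ∧ ∀ (A : Finset Link) (N C : ℝ), 0 < C → IsIndependent γ (fun x => x ^ δ) A →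
      IsInterferenceLimited α β N ε (obliviousPower α τ C) A →
      IsPFeasible α β N (obliviousPower α τ C) A := by
  -- Being interference limited, a link loses at most the share `1 / (1 + ε)` of its signal to `β *
  -- N`; the interference may use the remaining `ε / (1 + ε)`.
  obtain ⟨γ, hγ, h⟩ := exists_sum_oblivious_le (η := ε / ((1 + ε) * β)) hα hτ hτδ hδ hτδα
    (by positivity)
  refine ⟨γ, hγ, fun A N C hC hA hlim => ⟨fun i _ => ?_, fun i hi => ⟨fun j hj hji => ?_, ?_⟩⟩⟩
  · have := i.length_pos
    unfold obliviousPower; positivity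
  · have h1 := hA.le_linkDist (by linarith) (fun x hx => Real.one_le_rpow hx (by linarith))
      hj hi hji (min_le_left _ _) (min_le_right _ _)
    have h2 : 0 < γ * min j.length i.length :=
      mul_pos (by linarith) (lt_min j.length_pos i.length_pos)
    exact dist_pos.1 (h2.trans_le (h1.trans (linkDist_le_sender_receiver j i)))
  · have hi0 := i.length_pos
    set s := signal α (obliviousPower α τ C) i with hs
    have hs0 : 0 < s := by
      rw [hs, signal, obliviousPower]; positivity
    have hnoise : (1 + ε) * β * N ≤ s := by
      rw [hs, signal, le_div_iff₀ (by positivity)]; exact hlim i hi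
    have hterm : ∀ j, interference α (obliviousPower α τ C) j i =
        j.length ^ (τ * α) * i.length ^ ((1 - τ) * α) * (1 / dist j.sender i.receiver ^ α) * s := by
      intro j
      have e1 : i.length ^ α = i.length ^ (τ * α) * i.length ^ ((1 - τ) * α) := by
        rw [← Real.rpow_add hi0]; congr 1; ring
      rw [hs, interference, signal, obliviousPower, obliviousPower, e1]
      field_simp
    have hsum : ∑ j ∈ A.erase i, interference α (obliviousPower α τ C) j i ≤
        ε / ((1 + ε) * β) * s := by
      rw [Finset.sum_congr rfl fun j _ => hterm j, ← Finset.sum_mul]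
      exact mul_le_mul_of_nonneg_right (h A hA i hi) hs0.le
    have h3 : β * (ε / ((1 + ε) * β) * s) = ε / (1 + ε) * s := by field_simp
    have h4 : β * N ≤ 1 / (1 + ε) * s := by
      rw [div_mul_eq_mul_div, le_div_iff₀ (by linarith)]; linarith
    have h5 : ε / (1 + ε) * s + 1 / (1 + ε) * s = s := by field_simp; ring
    have h6 := mul_le_mul_of_nonneg_left hsum hβ.le
    linarith

/-! ### Global power control -/

/-- Powers chosen from the longest link to the shortest one, each in terms of the interference
caused by the longer links. -/
theorem exists_power_recursion (α : ℝ) {M b : ℝ} (hM : 0 < M) (hb : 0 ≤ b) (A : Finset Link) :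
    ∃ (rank : Link → ℕ) (P : Link → ℝ), (∀ i ∈ A, ∀ j ∈ A, rank i = rank j → i = j) ∧
      (∀ i ∈ A, ∀ j ∈ A, rank i < rank j → j.length ≤ i.length) ∧ (∀ i ∈ A, 0 < P i) ∧
      ∀ k ∈ A, P k = k.length ^ α *
        (M + b * ∑ j ∈ A with rank j < rank k, interference α P j k) := by
  induction A using Finset.induction_on_min_value Link.length with
  | empty => exact ⟨fun _ => 0, fun _ => 0, by simp⟩
  | insert a s ha hmin ih =>
    obtain ⟨rank, P, hinj, hrank, hpos, hP⟩ := ih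
    have hne : ∀ i ∈ s, i ≠ a := fun i hi e => ha (e ▸ hi)
    -- The inserted link is a shortest one and receives the highest rank; ranks also break ties
    -- between equal lengths.
    set n := s.sup rank + 1
    have hn : ∀ i ∈ s, rank i < n := fun i hi => Nat.lt_succ_of_le (Finset.le_sup hi)
    set p := a.length ^ α * (M + b * ∑ j ∈ s, interference α P j a)
    have hra : Function.update rank a n a = n := Function.update_self ..
    have hrs : ∀ i ∈ s, Function.update rank a n i = rank i := fun i hi =>
      Function.update_of_ne (hne i hi) ..
    have hPs : ∀ i ∈ s, Function.update P a p i = P i := fun i hi =>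
      Function.update_of_ne (hne i hi) ..
    have hIs : ∀ j ∈ s, ∀ k, interference α (Function.update P a p) j k = interference α P j k :=
      fun j hj k => by rw [interference, interference, hPs j hj]
    refine ⟨Function.update rank a n, Function.update P a p, ?_, ?_, ?_, ?_⟩
    · intro i hi j hj
      rcases Finset.mem_insert.1 hi with rfl | hi' <;> rcases Finset.mem_insert.1 hj with rfl | hj'
      · exact fun _ => rfl
      · rw [hra, hrs j hj']; intro h; exact absurd h (hn j hj').ne'
      · rw [hra, hrs i hi']; intro h; exact absurd h (hn i hi').ne
      · rw [hrs i hi', hrs j hj']; exact hinj i hi' j hj'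
    · intro i hi j hj
      rcases Finset.mem_insert.1 hi with rfl | hi' <;> rcases Finset.mem_insert.1 hj with rfl | hj'
      · exact fun _ => le_rfl
      · rw [hra, hrs j hj']; intro h; exact absurd h (hn j hj').not_gt
      · exact fun _ => hmin i hi'
      · rw [hrs i hi', hrs j hj']; exact hrank i hi' j hj'
    · intro i hi
      rcases Finset.mem_insert.1 hi with rfl | hi'
      · rw [Function.update_self]
        have h1 : 0 ≤ ∑ j ∈ s, interference α P j i := Finset.sum_nonneg fun j hj => by
          have := hpos j hj
          unfold interference; positivity
        have := i.length_pos
        positivity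
      · rw [hPs i hi']; exact hpos i hi'
    · intro k hk
      rcases Finset.mem_insert.1 hk with rfl | hk'
      · rw [Function.update_self, Finset.filter_insert, if_neg (lt_irrefl _), hra,
          Finset.filter_true_of_mem fun j hj => by rw [hrs j hj]; exact hn j hj,
          Finset.sum_congr rfl fun j hj => hIs j hj k]
      · rw [hPs k hk', hP k hk', Finset.filter_insert,
          if_neg (by rw [hra, hrs k hk']; exact (hn k hk').not_gt),
          Finset.filter_congr fun j hj => by rw [← hrs j hj, ← hrs k hk'],
          Finset.sum_congr rfl fun j hj => (hIs j (Finset.mem_filter.1 hj).1 k).symm]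

/-- The larger of `a` and `b` is at least `d / 3`, so its factor is absorbed into `3 ^ α / d ^ α`.
This replaces the path from `j` via `k` to `i` by the direct interference of `j` on `i`. -/
theorem inv_rpow_mul_inv_rpow_le {α a b d : ℝ} (hα : 0 ≤ α) (ha : 0 < a) (hb : 0 < b) (hd : 0 < d)
    (h : d ≤ 3 * max a b) :
    1 / a ^ α * (1 / b ^ α) ≤ 3 ^ α * (1 / d ^ α) * (1 / a ^ α + 1 / b ^ α) := by
  have key : ∀ c : ℝ, 0 < c → d ≤ 3 * c → 1 / c ^ α ≤ 3 ^ α * (1 / d ^ α) := by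
    intro c hc hdc
    have : d ^ α ≤ 3 ^ α * c ^ α := by
      rw [← Real.mul_rpow (by norm_num) hc.le]; gcongr
    rw [mul_one_div, div_le_div_iff₀ (by positivity) (by positivity)]
    linarith
  have ha' : 0 < 1 / a ^ α := by positivity
  have hb' : 0 < 1 / b ^ α := by positivity
  rcases le_total a b with hab | hab
  · rw [max_eq_right hab] at h
    have := key b hb h
    nlinarith
  · rw [max_eq_left hab] at h
    have := key a ha h
    nlinarith

/-- Kesselheim's criterion for feasibility under power control. -/
theorem isFeasible_of_sum_le {α β N ε : ℝ} (hα : 0 < α) (hβ : 0 < β) (hN : 0 ≤ N) (hε : 0 < ε)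
    {A : Finset Link}
    (hd : ∀ k ∈ A, ∀ i ∈ A, k ≠ i → k.length ≤ i.length → k.length ≤ linkDist k i)
    (hs : ∀ i ∈ A, ∑ k ∈ A with k ≠ i ∧ k.length ≤ i.length,
      k.length ^ α * (1 / dist k.sender i.receiver ^ α) ≤ 1 / (16 * 3 ^ α * β * (2 * β + 1)))
    (hr : ∀ i ∈ A, ∑ k ∈ A with k ≠ i ∧ k.length ≤ i.length,
      k.length ^ α * (1 / dist k.receiver i.sender ^ α) ≤ 1 / (16 * 3 ^ α * β * (2 * β + 1))) :
    IsFeasible α β N ε A := by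
  set η := 1 / (16 * 3 ^ α * β * (2 * β + 1)) with hη
  have hη0 : 0 < η := by positivity
  -- The three summands pay for the noise, for being interference limited, and for positivity.
  set M := 2 * β * N + (1 + ε) * β * N + 1 with hM
  have hM0 : 0 < M := by positivity
  obtain ⟨rank, P, hinj, hrank, hpos, hP⟩ := exists_power_recursion α hM0
    (by positivity : 0 ≤ 2 * β) A
  have hpd : ∀ i ∈ A, ∀ j ∈ A, i ≠ j → 0 < linkDist i j := by
    intro i hi j hj hij
    rcases le_total i.length j.length with h | h
    · exact i.length_pos.trans_le (hd i hi j hj hij h)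
    · rw [linkDist_comm]; exact j.length_pos.trans_le (hd j hj i hi hij.symm h)
  have hInn : ∀ j ∈ A, ∀ i, 0 ≤ interference α P j i := fun j hj i => by
    have := hpos j hj
    unfold interference; positivity
  have hsr : ∀ j ∈ A, ∀ i ∈ A, 0 < dist j.sender i.receiver := by
    intro j hj i hi
    by_cases h : j = i
    · subst h; exact j.length_pos
    · exact (hpd j hj i hi h).trans_le (linkDist_le_sender_receiver j i)
  have hS : ∀ i ∈ A, signal α P i =
      M + 2 * β * ∑ j ∈ A with rank j < rank i, interference α P j i := by
    intro i hi
    have := i.length_pos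
    rw [signal, div_eq_iff (by positivity), mul_comm]
    exact hP i hi
  have hafter : ∀ i ∈ A, (A.filter fun k => rank i < rank k) ⊆
      A.filter fun k => k ≠ i ∧ k.length ≤ i.length := by
    intro i hi k hk
    obtain ⟨hk, hik⟩ := Finset.mem_filter.1 hk
    exact Finset.mem_filter.2 ⟨hk, fun e => by subst e; exact lt_irrefl _ hik, hrank i hi k hk hik⟩
  have hw : ∀ i ∈ A, ∑ k ∈ A with rank i < rank k,
      k.length ^ α * (1 / dist k.sender i.receiver ^ α) ≤ η := fun i hi =>
    (Finset.sum_le_sum_of_subset_of_nonneg (hafter i hi) fun k _ _ => by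
      have := k.length_pos; positivity).trans (hs i hi)
  have hv : ∀ i ∈ A, ∑ k ∈ A with rank i < rank k,
      k.length ^ α * (1 / dist i.sender k.receiver ^ α) ≤ η := fun i hi => by
    simp_rw [dist_comm i.sender]
    exact (Finset.sum_le_sum_of_subset_of_nonneg (hafter i hi) fun k _ _ => by
      have := k.length_pos; positivity).trans (hr i hi)
  refine ⟨P, fun i hi => ?_, hpos, fun i hi => ⟨fun j hj hji => ?_, ?_⟩⟩
  · rw [hP i hi, mul_comm]
    have h1 : 0 ≤ ∑ j ∈ A with rank j < rank i, interference α P j i :=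
      Finset.sum_nonneg fun j hj => hInn j (Finset.mem_filter.1 hj).1 i
    have h2 := i.length_pos
    gcongr
    have : 0 ≤ 2 * β * ∑ j ∈ A with rank j < rank i, interference α P j i := by positivity
    have : 0 ≤ 2 * β * N := by positivity
    linarith
  · exact dist_pos.1 (hsr j hj i hi)
  have hi0 := i.length_pos
  set I := ∑ j ∈ A with rank j < rank i, interference α P j i with hI
  set X := ∑ k ∈ A with rank i < rank k, interference α P k i with hX
  have hsplit : A.erase i = (A.filter fun j => rank j < rank i) ∪
      A.filter fun k => rank i < rank k := by
    ext k
    simp only [Finset.mem_erase, Finset.mem_union, Finset.mem_filter]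
    constructor
    · rintro ⟨hki, hk⟩
      rcases lt_trichotomy (rank k) (rank i) with h | h | h
      · exact Or.inl ⟨hk, h⟩
      · exact absurd (hinj k hk i hi h) hki
      · exact Or.inr ⟨hk, h⟩
    · rintro (⟨hk, h⟩ | ⟨hk, h⟩)
      · exact ⟨fun e => by subst e; exact lt_irrefl _ h, hk⟩
      · exact ⟨fun e => by subst e; exact lt_irrefl _ h, hk⟩
  have hdisj : Disjoint (A.filter fun j => rank j < rank i) (A.filter fun k => rank i < rank k) :=
    Finset.disjoint_left.2 fun k h1 h2 =>
      lt_asymm (Finset.mem_filter.1 h1).2 (Finset.mem_filter.1 h2).2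
  -- The sum includes `i` itself, whose interference at its own receiver is its signal.
  have hall : ∑ j ∈ A, interference α P j i = signal α P i + (I + X) := by
    rw [← Finset.add_sum_erase A _ hi, hsplit, Finset.sum_union hdisj]
    rfl
  have hI0 : 0 ≤ I := Finset.sum_nonneg fun j hj => hInn j (Finset.mem_filter.1 hj).1 i
  -- the interference of a shorter link `k`
  have hk_le : ∀ k ∈ A.filter fun k => rank i < rank k, interference α P k i ≤
      M * (k.length ^ α * (1 / dist k.sender i.receiver ^ α)) +
      2 * β * 3 ^ α * ∑ j ∈ A with rank j < rank k, interference α P j i *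
        (k.length ^ α * (1 / dist k.sender i.receiver ^ α) +
          k.length ^ α * (1 / dist j.sender k.receiver ^ α)) := by
    intro k hk
    obtain ⟨hk, hik⟩ := Finset.mem_filter.1 hk
    have hk0 := k.length_pos
    have hki : k ≠ i := fun e => by subst e; exact lt_irrefl _ hik
    have e1 : interference α P k i = M * (k.length ^ α * (1 / dist k.sender i.receiver ^ α)) +
        2 * β * ∑ j ∈ A with rank j < rank k, interference α P j k *
          (k.length ^ α * (1 / dist k.sender i.receiver ^ α)) := by
      rw [← Finset.sum_mul, interference, hP k hk]
      ring
    rw [e1, mul_assoc (2 * β), Finset.mul_sum _ _ ((3 : ℝ) ^ α)]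
    refine add_le_add le_rfl (mul_le_mul_of_nonneg_left (Finset.sum_le_sum fun j hj => ?_)
      (by positivity))
    have hj := (Finset.mem_filter.1 hj).1
    have htri : dist j.sender i.receiver ≤
        3 * max (dist k.sender i.receiver) (dist j.sender k.receiver) := by
      have h1 := dist_triangle4 j.sender k.receiver k.sender i.receiver
      have h2 := (hd k hk i hi hki (hrank i hi k hk hik)).trans (linkDist_le_sender_receiver k i)
      rw [Link.length, dist_comm] at h2
      have h3 := le_max_left (dist k.sender i.receiver) (dist j.sender k.receiver)
      have h4 := le_max_right (dist k.sender i.receiver) (dist j.sender k.receiver)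
      linarith
    have h5 := inv_rpow_mul_inv_rpow_le hα.le (hsr k hk i hi) (hsr j hj k hk) (hsr j hj i hi) htri
    have h6 : 0 ≤ P j * k.length ^ α := by have := hpos j hj; positivity
    calc _ = P j * k.length ^ α * (1 / dist k.sender i.receiver ^ α *
          (1 / dist j.sender k.receiver ^ α)) := by rw [interference]; ring
      _ ≤ _ := mul_le_mul_of_nonneg_left h5 h6
      _ = _ := by rw [interference]; ring
  -- Exchanging the sums bounds `X` by a small multiple of a total that contains `X`. As `κ ≤ 1 /
  -- 4`, this can be solved for `X`, giving `β * X ≤ s / 2`; the other half of `s` covers `β * (I +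
  -- N)` by the choice of powers.
  have hXle : X ≤ M * η + 2 * β * 3 ^ α * ((signal α P i + (I + X)) * (2 * η)) := by
    refine (Finset.sum_le_sum hk_le).trans ?_
    rw [Finset.sum_add_distrib, ← Finset.mul_sum, ← Finset.mul_sum]
    refine add_le_add (mul_le_mul_of_nonneg_left (hw i hi) hM0.le)
      (mul_le_mul_of_nonneg_left ?_ (by positivity))
    rw [Finset.sum_comm' (t' := A) (s' := fun j => A.filter fun k => rank i < rank k ∧
      rank j < rank k) (by intro k j; simp only [Finset.mem_filter]; tauto), ← hall, Finset.sum_mul]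
    refine Finset.sum_le_sum fun j hj => ?_
    rw [← Finset.mul_sum, Finset.sum_add_distrib]
    refine mul_le_mul_of_nonneg_left ?_ (hInn j hj i)
    have h1 := (Finset.sum_le_sum_of_subset_of_nonneg
      (s := A.filter fun k => rank i < rank k ∧ rank j < rank k)
      (t := A.filter fun k => rank i < rank k)
      (f := fun k => k.length ^ α * (1 / dist k.sender i.receiver ^ α))
      (fun k hk => by simp only [Finset.mem_filter] at hk ⊢; tauto)
      (fun k _ _ => by have := k.length_pos; positivity)).trans (hw i hi)
    have h2 := (Finset.sum_le_sum_of_subset_of_nonneg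
      (s := A.filter fun k => rank i < rank k ∧ rank j < rank k)
      (t := A.filter fun k => rank j < rank k)
      (f := fun k => k.length ^ α * (1 / dist j.sender k.receiver ^ α))
      (fun k hk => by simp only [Finset.mem_filter] at hk ⊢; tauto)
      (fun k _ _ => by have := k.length_pos; positivity)).trans (hv j hj)
    linarith
  have hSi := hS i hi
  rw [hsplit, Finset.sum_union hdisj, ← hI, ← hX]
  rw [← hI] at hSi
  set s := signal α P i
  have hκ : 4 * β * 3 ^ α * η * (4 * (2 * β + 1)) = 1 := by
    rw [hη]; field_simp; ring
  set κ := 4 * β * 3 ^ α * η with hκdef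
  have hκ0 : 0 < κ := by positivity
  have hη8 : 8 * β * η ≤ 1 := by
    have h3 : (1 : ℝ) ≤ 3 ^ α := Real.one_le_rpow (by norm_num) hα.le
    have h4 : 0 < β * η := by positivity
    have h5 : 16 * (β * η) * 1 * (2 * β + 1) ≤ 16 * (β * η) * 3 ^ α * (2 * β + 1) := by gcongr
    nlinarith
  have hX' : X ≤ M * η + κ * (s + (I + X)) := hXle.trans_eq (by rw [hκdef]; ring)
  have hX0 : 0 ≤ X := Finset.sum_nonneg fun j hj => hInn j (Finset.mem_filter.1 hj).1 i
  have hκ4 : κ ≤ 1 / 4 := by nlinarith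
  have hMs : M ≤ s := by
    have : 0 ≤ 2 * β * I := by positivity
    linarith
  have hX2 : X ≤ 2 * (M * η) + 2 * (κ * (s + I)) := by nlinarith
  have hβX : 2 * β * X ≤ s := by
    have h1 : 4 * β * (M * η) ≤ s / 2 := by nlinarith
    have h2 : 2 * β * I ≤ s := by linarith
    have h3 : 4 * β * (κ * (s + I)) ≤ s / 2 := by
      have : 4 * β * (κ * (s + I)) ≤ 2 * κ * ((2 * β + 1) * s) := by nlinarith
      have e : 2 * κ * ((2 * β + 1) * s) = (κ * (4 * (2 * β + 1))) * s / 2 := by ring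
      rw [e, hκ] at this
      linarith
    nlinarith
  have hNM : 2 * (β * N) ≤ M := by
    have : 0 ≤ (1 + ε) * β * N := by positivity
    linarith
  linarith

theorem one_add_logb_pow_mono (p : ℕ) (x y : ℝ) (hx : 1 ≤ x) (hxy : x ≤ y) :
    (1 + Real.logb 2 x) ^ p ≤ (1 + Real.logb 2 y) ^ p := by
  have h1 : 0 ≤ Real.logb 2 x := Real.logb_nonneg (by norm_num) hx
  have h2 : Real.logb 2 x ≤ Real.logb 2 y :=
    Real.logb_le_logb_of_le (by norm_num) (by linarith) hxy
  gcongr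

/-- The short-link sums are needed with `τ = 1`, where the geometric factor disappears and the
series is that of `(t + 1) ^ (p * (2 - α))`. So a power of the logarithm suffices for `φ`. -/
theorem exists_independent_isFeasible {α β : ℝ} (hα : 2 < α) (hβ : 0 < β) {p : ℕ}
    (hp : 1 < p * (α - 2)) :
    ∃ γ : ℝ, 1 ≤ γ ∧ ∀ (A : Finset Link) (N ε : ℝ), 0 ≤ N → 0 < ε →
      IsIndependent γ (fun x => (1 + Real.logb 2 x) ^ p) A → IsFeasible α β N ε A := by
  set φ : ℝ → ℝ := fun x => (1 + Real.logb 2 x) ^ p with hφdef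
  have hlog : ∀ x : ℝ, 1 ≤ x → 0 ≤ Real.logb 2 x := fun x hx => Real.logb_nonneg (by norm_num) hx
  have hφ : ∀ x y : ℝ, 1 ≤ x → x ≤ y → φ x ≤ φ y := one_add_logb_pow_mono p
  have hφ1 : ∀ x : ℝ, 1 ≤ x → 1 ≤ φ x := fun x hx =>
    one_le_pow₀ (by have := hlog x hx; linarith)
  have hsum : Summable fun t : ℕ => ((2 : ℝ) ^ t) ^ (α * (1 - 1)) * φ (2 ^ t) ^ (2 - α) := by
    have h1 : Summable fun t : ℕ => ((t + 1 : ℕ) : ℝ) ^ (p * (2 - α)) :=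
      (summable_nat_add_iff 1 (f := fun n : ℕ => (n : ℝ) ^ (p * (2 - α)))).2
        (Real.summable_nat_rpow.2 (by linarith))
    refine h1.congr fun t => ?_
    have h2 : Real.logb 2 ((2 : ℝ) ^ t) = t := by
      rw [← Real.rpow_natCast, Real.logb_rpow (by norm_num) (by norm_num)]
    rw [sub_self, mul_zero, Real.rpow_zero, one_mul]
    simp only [hφdef]
    rw [h2, ← Real.rpow_natCast, ← Real.rpow_mul (by positivity)]
    push_cast
    rw [add_comm]
  obtain ⟨γ, hγ1, hγ⟩ := exists_large_scale (α := α)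
    (η := 1 / (16 * 3 ^ α * β * (2 * β + 1))) (by linarith) (by positivity)
    (c := packingConst α * 2 ^ α *
        ∑' t : ℕ, ((2 : ℝ) ^ t) ^ (α * (1 - 1)) * φ (2 ^ t) ^ (2 - α))
  have hγ0 : 0 < γ := by linarith
  have hle : packingConst α * (2 / γ) ^ α *
      ∑' t : ℕ, ((2 : ℝ) ^ t) ^ (α * (1 - 1)) * φ (2 ^ t) ^ (2 - α) ≤
      1 / (16 * 3 ^ α * β * (2 * β + 1)) := by
    rw [Real.div_rpow (by norm_num) hγ0.le]
    exact le_trans (le_of_eq (by ring)) hγ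
  refine ⟨γ, hγ1, fun A N ε hN hε hA => isFeasible_of_sum_le (by linarith) hβ hN hε ?_ ?_ ?_⟩
  · intro k hk i hi hki hle
    refine le_trans ?_ (hA.le_linkDist hγ0 hφ1 hk hi hki le_rfl hle)
    exact le_mul_of_one_le_left k.length_pos.le hγ1
  · intro i hi
    have := hA.sum_short_le hα hγ0 hφ hφ1 hi (e := Link.sender) (x := i.receiver)
      linkDist_le_sender_sender (fun k => linkDist_le_sender_receiver k i) zero_le_one hsum
    simp only [one_mul, sub_self, zero_mul, Real.rpow_zero, mul_one] at this hle
    exact this.trans hle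
  · intro i hi
    have := hA.sum_short_le hα hγ0 hφ hφ1 hi (e := Link.receiver) (x := i.sender)
      linkDist_le_receiver_receiver (fun k => linkDist_le_receiver_sender k i) zero_le_one hsum
    simp only [one_mul, sub_self, zero_mul, Real.rpow_zero, mul_one] at this hle
    exact this.trans hle

/-! ### Covering the length ratios by few intervals -/

theorem exists_oblivious_cover {δ : ℝ} (hδ0 : 0 < δ) (hδ1 : δ < 1) (x : ℝ) :
    ∃ (m : ℕ) (a b : Option (Fin m) → ℝ),
      (m : ℝ) + 1 ≤ (1 / Real.logb 2 (1 / δ) + 2) * max 1 (Real.logb 2 (Real.logb 2 x)) ∧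
      (∀ k, 0 < a k) ∧ (∀ k, b k ^ δ ≤ 2 * a k) ∧
      ∀ y, 1 ≤ y → y ≤ x → ∃ k, a k ≤ y ∧ y ≤ b k := by
  have hδ' : 1 < 1 / δ := by rwa [lt_div_iff₀ hδ0, one_mul]
  set q := 1 / δ with hq
  set c := Real.logb 2 q with hc
  have hc0 : 0 < c := Real.logb_pos (by norm_num) hδ'
  set z := Real.logb 2 (Real.logb 2 x) with hz
  -- With `q = 1 / δ`, the right end of `[2 ^ q ^ k, 2 ^ q ^ (k + 1)]` raised to `δ` is its left
  -- end, and `q ^ k ≤ logb 2 x` leaves about `z / c` values of `k`. The index `none` covers `[1,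
  -- 2]`.
  refine ⟨⌊z / c⌋₊ + 1, fun k => k.elim 1 fun k => 2 ^ (q ^ (k : ℕ)),
    fun k => k.elim 2 fun k => 2 ^ (q ^ ((k : ℕ) + 1)), ?_, ?_, ?_, ?_⟩
  · have h1 : (⌊z / c⌋₊ : ℝ) ≤ max 1 z / c :=
      (Nat.floor_le_floor (by gcongr; exact le_max_right _ _) |> Nat.cast_le.2).trans
        (Nat.floor_le (by positivity))
    have h2 := le_max_left 1 z
    push_cast
    calc _ ≤ max 1 z / c + 2 * max 1 z := by linarith
      _ = _ := by ring
  · rintro (_ | k) <;> simp only [Option.elim] <;> positivity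
  · rintro (_ | k)
    · simp only [Option.elim]
      have := Real.rpow_le_self_of_one_le (by norm_num : (1 : ℝ) ≤ 2) hδ1.le
      linarith
    · simp only [Option.elim]
      rw [← Real.rpow_mul (by norm_num), pow_succ, mul_assoc, hq, one_div_mul_cancel hδ0.ne',
        mul_one]
      have : (0 : ℝ) < 2 ^ ((1 / δ) ^ (k : ℕ)) := by positivity
      linarith
  · intro y hy hyx
    rcases le_total y 2 with h2 | h2
    · exact ⟨none, hy, h2⟩
    have hy0 : 0 < y := by linarith
    obtain ⟨k, hk1, hk2⟩ := exists_nat_pow_near (x := Real.logb 2 y) (y := q)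
      (by rw [Real.le_logb_iff_rpow_le (by norm_num) hy0]; simpa using h2) hδ'
    have hkx : q ^ k ≤ Real.logb 2 x :=
      hk1.trans (Real.logb_le_logb_of_le (by norm_num) hy0 hyx)
    have hkz : (k : ℝ) * c ≤ z := by
      have := Real.logb_le_logb_of_le (b := 2) (by norm_num) (by positivity) hkx
      rwa [Real.logb_pow] at this
    have hkm : k ≤ ⌊z / c⌋₊ := Nat.le_floor (by rwa [le_div_iff₀ hc0])
    refine ⟨some ⟨k, Nat.lt_succ_of_le hkm⟩, ?_, ?_⟩
    · exact (Real.le_logb_iff_rpow_le (by norm_num) hy0).1 hk1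
    · exact (Real.logb_le_iff_le_rpow (by norm_num) hy0).1 hk2.le

/-- The tower `1, 2, 2 ^ 2, 2 ^ 2 ^ 2, …`. -/
noncomputable def tower (n : ℕ) : ℝ := (fun x : ℝ => (2 : ℝ) ^ x)^[n] 1

theorem tower_succ (n : ℕ) : tower (n + 1) = 2 ^ tower n := Function.iterate_succ_apply' _ _ _

theorem one_le_tower (n : ℕ) : 1 ≤ tower n := by
  induction n with
  | zero => exact le_rfl
  | succ n ih => rw [tower_succ]; exact Real.one_le_rpow (by norm_num) (by linarith)

theorem le_tower_of_iterate_logb_le_one (n : ℕ) :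
    ∀ x : ℝ, (Real.logb 2)^[n] x ≤ 1 → x ≤ tower n := by
  induction n with
  | zero => exact fun x hx => hx
  | succ n ih =>
    intro x hx
    -- For `x ≤ 0` the value of `Real.logb` carries no information, but the bound is trivial.
    rcases le_or_gt x 0 with h | h
    · linarith [one_le_tower (n + 1)]
    · rw [tower_succ, ← Real.logb_le_iff_le_rpow (by norm_num) h]
      exact ih _ hx

theorem le_tower_logStar (x : ℝ) : x ≤ tower (logStar x) :=
  le_tower_of_iterate_logb_le_one _ _ (Nat.sInf_mem (exists_iterate_logb_le_one x))

theorem pow_le_mul_two_rpow {s : ℝ} (hs : 0 ≤ s) (n : ℕ) :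
    s ^ n ≤ n.factorial / Real.log 2 ^ n * 2 ^ s := by
  have hl : 0 < Real.log 2 := Real.log_pos (by norm_num)
  have h := Real.pow_div_factorial_le_exp (Real.log 2 * s) (by positivity) n
  rw [Real.rpow_def_of_pos (by norm_num)]
  rw [mul_pow, div_le_iff₀ (by positivity)] at h
  rw [div_mul_eq_mul_div, le_div_iff₀ (by positivity)]
  linarith

/-- At the right end of `[tower k, tower (k + 1)]` the function is of order `tower k ^ p`, too large
for the left end if `p > 1`. Splitting at `2 ^ r` with `r = tower k ^ (1 / p)` helps: at `2 ^ r` it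
is of order `r ^ p = tower k`, and at `tower (k + 1)` of order `r ^ (p * p)`, which `2 ^ r`
dominates. -/
theorem exists_logStar_cover {p : ℕ} (hp : 0 < p) :
    ∃ B : ℝ, ∀ x : ℝ, ∃ a b : Fin (logStar x + 1) × Bool → ℝ,
      (∀ k, 0 < a k) ∧ (∀ k, (1 + Real.logb 2 (b k)) ^ p ≤ B * a k) ∧
      ∀ y, 1 ≤ y → y ≤ x → ∃ k, a k ≤ y ∧ y ≤ b k := by
  have hl : 0 < Real.log 2 := Real.log_pos (by norm_num)
  set c : ℝ := (p * p).factorial / Real.log 2 ^ (p * p) with hc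
  have hc0 : 0 < c := by positivity
  refine ⟨2 ^ p * (1 + c), fun x => ?_⟩
  set r : ℕ → ℝ := fun k => tower k ^ (1 / p : ℝ) with hr
  have hr1 : ∀ k, 1 ≤ r k := fun k => Real.one_le_rpow (one_le_tower k) (by positivity)
  have hrp : ∀ k, r k ^ p = tower k := fun k => by
    rw [hr]
    simp only
    rw [one_div, Real.rpow_inv_natCast_pow (by linarith [one_le_tower k]) hp.ne']
  have hpow : ∀ s : ℝ, 1 ≤ s → (1 + s) ^ p ≤ 2 ^ p * s ^ p := fun s hs => by
    rw [← mul_pow]; gcongr; linarith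
  refine ⟨fun k => if k.2 then 2 ^ r k.1 else tower k.1,
    fun k => if k.2 then tower (k.1 + 1) else 2 ^ r k.1, ?_, ?_, ?_⟩
  · rintro ⟨k, _ | _⟩
    · simpa using zero_lt_one.trans_le (one_le_tower k)
    · simpa using by positivity
  · rintro ⟨k, _ | _⟩
    · simp only [Bool.false_eq_true, if_false]
      rw [Real.logb_rpow (by norm_num) (by norm_num)]
      refine (hpow _ (hr1 k)).trans ?_
      rw [hrp, mul_assoc]
      have := one_le_tower k
      gcongr
      nlinarith
    · simp only [if_true]
      rw [tower_succ, Real.logb_rpow (by norm_num) (by norm_num)]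
      refine (hpow _ (one_le_tower k)).trans ?_
      have h1 := pow_le_mul_two_rpow (by linarith [hr1 k] : 0 ≤ r k) (p * p)
      rw [pow_mul, hrp, ← hc] at h1
      have h2 : (0 : ℝ) < 2 ^ r k := by positivity
      rw [mul_assoc]
      gcongr
      linarith
  · intro y hy hyx
    have hex : ∃ m, y ≤ tower m := ⟨_, hyx.trans (le_tower_logStar x)⟩
    obtain ⟨k, hk, hk1, hk2⟩ : ∃ k < logStar x + 1, tower k ≤ y ∧ y ≤ tower (k + 1) := by
      classical
      have hle : Nat.find hex ≤ logStar x := Nat.find_min' hex (hyx.trans (le_tower_logStar x))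
      have hspec := Nat.find_spec hex
      rcases h : Nat.find hex with _ | k
      · rw [h] at hspec
        refine ⟨0, by omega, hy, hspec.trans ?_⟩
        exact one_le_tower 1
      · rw [h] at hspec
        exact ⟨k, by omega, (not_le.1 (Nat.find_min hex (by omega : k < Nat.find hex))).le, hspec⟩
    rcases le_total y (2 ^ r k) with h | h
    · exact ⟨(⟨k, hk⟩, false), by simpa using hk1, by simpa using h⟩
    · exact ⟨(⟨k, hk⟩, true), by simpa using h, by simpa using hk2⟩

/-! ### Schedules -/

theorem exists_schedule_global {α β : ℝ} (hα : 2 < α) (hβ : 0 < β) :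
    ∃ K : ℝ, 0 < K ∧ ∀ N ε : ℝ, 0 ≤ N → 0 < ε → ∀ S : Finset Link, ExchangeProperty S →
      ∃ schedule : Finpartition S, (∀ A ∈ schedule.parts, IsFeasible α β N ε A) ∧
        (schedule.parts.card : ℝ) ≤ K * max 1 (logStar (lengthDiversity S) : ℝ) := by
  have hα0 : 0 < α - 2 := by linarith
  obtain ⟨p, hp⟩ := exists_nat_gt (1 / (α - 2))
  have hp0 : 0 < p := by
    have : (0 : ℝ) < p := (by positivity : 0 < 1 / (α - 2)).trans hp
    exact_mod_cast this
  rw [div_lt_iff₀ hα0] at hp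
  obtain ⟨γ, hγ, hfeas⟩ := exists_independent_isFeasible hα hβ hp
  obtain ⟨B, hB⟩ := exists_logStar_cover hp0
  refine ⟨4 * nearConst (γ * B) + 1, by positivity, fun N ε hN hε S hS => ?_⟩
  obtain ⟨a, b, ha, hab, hcov⟩ := hB (lengthDiversity S)
  obtain ⟨Q, hQ, hcard⟩ := hS.exists_independent_partition (by linarith : 0 ≤ γ)
    (one_add_logb_pow_mono p) a b ha hab hcov
  refine ⟨Q, fun A hA => hfeas A N ε hN hε (hQ A hA), ?_⟩
  rw [Fintype.card_prod, Fintype.card_fin, Fintype.card_bool] at hcard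
  have hcard' : (Q.parts.card : ℝ) ≤
      (logStar (lengthDiversity S) + 1) * 2 * nearConst (γ * B) + 1 := by exact_mod_cast hcard
  have h1 := le_max_left (1 : ℝ) (logStar (lengthDiversity S))
  have h2 := le_max_right (1 : ℝ) (logStar (lengthDiversity S))
  have h3 : (0 : ℝ) ≤ nearConst (γ * B) := by positivity
  nlinarith

theorem exists_schedule_oblivious {α τ δ β ε : ℝ} (hα : 2 < α) (hτ : 0 ≤ τ) (hτδ : τ < δ)
    (hδ : δ < 1) (hτδα : α * (1 - τ) < δ * (α - 2)) (hβ : 0 < β) (hε : 0 < ε) :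
    ∃ K : ℝ, 0 < K ∧ ∀ (N C : ℝ), 0 < C → ∀ S : Finset Link, ExchangeProperty S →
      IsInterferenceLimited α β N ε (obliviousPower α τ C) S →
      ∃ schedule : Finpartition S,
        (∀ A ∈ schedule.parts, IsPFeasible α β N (obliviousPower α τ C) A) ∧
        (schedule.parts.card : ℝ) ≤
          K * max 1 (Real.logb 2 (Real.logb 2 (lengthDiversity S))) := by
  have hδ0 : 0 < δ := hτ.trans_lt hτδ
  obtain ⟨γ, hγ, hfeas⟩ :=
    exists_independent_isPFeasible_oblivious hα hτ hτδ hδ.le hτδα hβ hε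
  have hc : 0 < Real.logb 2 (1 / δ) :=
    Real.logb_pos (by norm_num) (by rwa [lt_div_iff₀ hδ0, one_mul])
  refine ⟨(1 / Real.logb 2 (1 / δ) + 2) * nearConst (γ * 2) + 1, by positivity,
    fun N C hC S hS hlim => ?_⟩
  obtain ⟨m, a, b, hm, ha, hab, hcov⟩ := exists_oblivious_cover hδ0 hδ (lengthDiversity S)
  obtain ⟨Q, hQ, hcard⟩ := hS.exists_independent_partition (by linarith : 0 ≤ γ)
    (φ := fun x => x ^ δ) (fun x y hx hxy => by gcongr) a b ha hab hcov
  refine ⟨Q, fun A hA => hfeas A N C hC (hQ A hA) fun i hi => hlim i (Q.le hA hi), ?_⟩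
  rw [Fintype.card_option, Fintype.card_fin] at hcard
  have hcard' : (Q.parts.card : ℝ) ≤ (m + 1) * nearConst (γ * 2) + 1 := by exact_mod_cast hcard
  have h1 := le_max_left (1 : ℝ) (Real.logb 2 (Real.logb 2 (lengthDiversity S)))
  have h2 := mul_le_mul_of_nonneg_right hm (by positivity : (0 : ℝ) ≤ nearConst (γ * 2))
  linarith

theorem theoremT (α : ℝ) (hα : 2 < α) :
    (∀ β : ℝ, 0 < β →
      ∃ K : ℝ, 0 < K ∧
        ∀ N ε : ℝ, 0 ≤ N → 0 < ε →
        ∀ (R : Finset Plane) (T : SimpleGraph R) (S : Finset Link),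
          IsMST T → IsOrientation T S →
          ∃ schedule : Finpartition S,
            (∀ A ∈ schedule.parts, IsFeasible α β N ε A) ∧
            (schedule.parts.card : ℝ) ≤ K * max 1 (logStar (lengthDiversity S) : ℝ)) ∧
    (∃ τ : ℝ, 0 < τ ∧ τ < 1 ∧
      ∀ β ε : ℝ, 0 < β → 0 < ε →
      ∃ K : ℝ, 0 < K ∧
        ∀ N : ℝ, 0 ≤ N →
        ∀ (R : Finset Plane) (T : SimpleGraph R) (S : Finset Link),
          IsMST T → IsOrientation T S →
          ∀ C : ℝ, 0 < C → IsInterferenceLimited α β N ε (obliviousPower α τ C) S →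
          ∃ schedule : Finpartition S,
            (∀ A ∈ schedule.parts, IsPFeasible α β N (obliviousPower α τ C) A) ∧
            (schedule.parts.card : ℝ) ≤
              K * max 1 (Real.logb 2 (Real.logb 2 (lengthDiversity S)))) := by
  refine ⟨fun β hβ => ?_, ?_⟩
  · obtain ⟨K, hK, h⟩ := exists_schedule_global hα hβ
    exact ⟨K, hK, fun N ε hN hε R T S hT hS => h N ε hN hε S (hT.exchangeProperty hS)⟩
  · have hα0 : 0 < α := by linarith
    -- The constraints allow some `δ < 1` only if `α * τ > 2`; this `τ` is the midpoint of `2 / α`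
    -- and `1`. Then `α * (1 - τ) = (α - 2) / 2`, and `δ = (1 + τ) / 2` exceeds `1 / 2`.
    set τ : ℝ := (α + 2) / (2 * α) with hτ
    have hτ0 : 0 < τ := by positivity
    have hτ1 : τ < 1 := by rw [hτ, div_lt_one (by positivity)]; linarith
    have hατ : α * τ = (α + 2) / 2 := by rw [hτ]; field_simp
    refine ⟨τ, hτ0, hτ1, fun β ε hβ hε => ?_⟩
    obtain ⟨K, hK, h⟩ := exists_schedule_oblivious (δ := (1 + τ) / 2) hα hτ0.le (by linarith)
      (by linarith) (by nlinarith) hβ hε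
    exact ⟨K, hK, fun N _ R T S hT hS C hC hlim =>
      h N C hC S (hT.exchangeProperty hS) hlim⟩
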